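/- All C*-algebras are complex, and a unital C*-algebra satisfies $1\neq 0$. A C*-algebra $B$ is \emph{simple} if $B\neq 0$ and its only norm-closed two-sided ideals are $\{0\}$ and $B$; a simple C*-algebra $B$ is \emph{purely infinite} if for all $a,b\in B$ with $a\neq 0$ there exist $x,y\in B$ with $xay=b$. An action $\alpha\colon\mathbb{T}\to\mathrm{Aut}(A)$ of the circle $\mathbb{T}=\{\zeta\in\mathbb{C}:|\zeta|=1\}$ on a unital C*-algebra $A$ is a group homomorphism into the $*$-automorphisms of $A$ such that $\zeta\mapsto\alpha_\zeta(a)$ is norm-continuous for every $a\in A$. It has the \emph{Rokhlin property} if for every $\varepsilon>0$ and every finite subset $F\subseteq A$ there is a unitary $u\in A$ such that $\|\alpha_\zeta(u)-\zeta u\|<\varepsilon$ for all $\zeta\in\mathbb{T}$ and $\|ua-au\|<\varepsilon$ for all $a\in F$. Write $A^\alpha=\{a\in A:\alpha_\zeta(a)=a\text{ for all }\zeta\in\mathbb{T}\}$ for the fixed point algebra, and $A\rtimes_\alpha\mathbb{T}$ for the crossed product, that is, the completion of $C(\mathbb{T},A)$, with convolution twisted by $\alpha$, in the norm $\|f\|=\sup_{(\pi,U)}\left\|\int_{\mathbb{T}}\pi(f(\zeta))U_\zeta\,d\zeta\right\|$,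 where $d\zeta$ is the normalized Haar measure and $(\pi,U)$ ranges over the covariant representations of $(A,\alpha)$ on Hilbert spaces ($\pi$ a unital $*$-representation of $A$, $U$ a strongly continuous unitary representation of $\mathbb{T}$, and $U_\zeta\pi(a)U_\zeta^*=\pi(\alpha_\zeta(a))$). \textbf{Theorem.} Let $A$ be a unital, simple, purely infinite C*-algebra, and let $\alpha\colon\mathbb{T}\to\mathrm{Aut}(A)$ be an action with the Rokhlin property. Then the fixed point algebra $A^\alpha$ and the crossed product $A\rtimes_\alpha\mathbb{T}$ are purely infinite simple C*-algebras. -/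

import Mathlib

open MeasureTheory
open scoped ENNReal

universe u

/-! ### Simple and purely infinite C⋆-algebras -/

/-- A C⋆-algebra is simple if it is nonzero and its only norm-closed two-sided ideals are `0` and
the whole algebra. -/
def IsSimpleCStarAlgebra (B : Type*) [NonUnitalCStarAlgebra B] : Prop :=
  Nontrivial B ∧ ∀ I : TwoSidedIdeal B, IsClosed (I : Set B) → I = ⊥ ∨ I = ⊤

/-- A C⋆-algebra `B` is purely infinite simple if it is simple and for all `a b : B` with `a ≠ 0`
there are `x y : B` with `x a y = b`. -/
def IsPurelyInfiniteSimple (B : Type*) [NonUnitalCStarAlgebra B] : Prop :=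
  IsSimpleCStarAlgebra B ∧ ∀ a b : B, a ≠ 0 → ∃ x y : B, x * a * y = b

/-! ### Circle actions -/

/-- A (continuous) action of the circle on the C⋆-algebra `A`: a group homomorphism into the
group of ⋆-automorphisms of `A`, continuous for the topology of pointwise norm convergence. -/
structure CircleAction (A : Type u) [CStarAlgebra A] where
  toHom : Circle →* (A ≃⋆ₐ[ℂ] A)
  continuous_apply : ∀ a : A, Continuous fun ζ : Circle => toHom ζ a

namespace CircleAction

noncomputable section

variable {A : Type u} [CStarAlgebra A]

instance : CoeFun (CircleAction A) (fun _ => Circle → (A ≃⋆ₐ[ℂ] A)) := ⟨fun α => α.toHom⟩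

/-- The Rokhlin property. -/
def HasRokhlinProperty (α : CircleAction A) : Prop :=
  ∀ ε : ℝ, 0 < ε → ∀ F : Finset A, ∃ u ∈ unitary A,
    (∀ ζ : Circle, ‖α ζ u - (ζ : ℂ) • u‖ < ε) ∧ ∀ a ∈ F, ‖u * a - a * u‖ < ε

/-- The fixed point algebra `A^α`. -/
def fixedPoints (α : CircleAction A) : StarSubalgebra ℂ A where
  carrier := {a | ∀ ζ : Circle, α ζ a = a}
  mul_mem' ha hb ζ := by rw [map_mul, ha ζ, hb ζ]
  one_mem' ζ := map_one (α ζ)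
  add_mem' ha hb ζ := by rw [map_add, ha ζ, hb ζ]
  zero_mem' ζ := map_zero (α ζ)
  algebraMap_mem' c ζ := by
    rw [Algebra.algebraMap_eq_smul_one, map_smul, map_one]
  star_mem' ha ζ := by rw [map_star, ha ζ]

instance isClosed_fixedPoints (α : CircleAction A) : IsClosed (α.fixedPoints : Set A) := by
  have h : (α.fixedPoints : Set A) = ⋂ ζ : Circle, {a | α ζ a = a} := by
    ext a
    simp [fixedPoints]
  rw [h]
  exact isClosed_iInter fun ζ =>
    isClosed_eq (AddMonoidHomClass.continuous_of_bound (α ζ) 1 fun a => by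
      simpa using NonUnitalStarAlgHom.norm_apply_le (α ζ) a) continuous_id

/-! ### The crossed product -/

instance measurableSpaceCircle : MeasurableSpace Circle := borel Circle

instance borelSpaceCircle : BorelSpace Circle := ⟨rfl⟩

/-- The normalized Haar measure on the circle. -/
def haarCircle : Measure Circle := Measure.haarMeasure ⊤

instance isProbabilityMeasure_haarCircle : IsProbabilityMeasure haarCircle :=
  ⟨Measure.haarMeasure_self⟩

/-- A covariant representation of `(A, α)`: a unital representation `π` of `A` and a strongly
continuous unitary representation `U` of the circle on a Hilbert space `H` such that
`U_ζ π(a) U_ζ⋆ = π(α_ζ(a))`. -/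
structure CovariantRep (α : CircleAction A) where
  H : Type u
  [normedAddCommGroup : NormedAddCommGroup H]
  [innerProductSpace : InnerProductSpace ℂ H]
  [completeSpace : CompleteSpace H]
  π : A →⋆ₐ[ℂ] (H →L[ℂ] H)
  U : Circle →* unitary (H →L[ℂ] H)
  continuous_U : ∀ ξ : H, Continuous fun ζ : Circle => (U ζ : H →L[ℂ] H) ξ
  covariant : ∀ (ζ : Circle) (a : A),
    (U ζ : H →L[ℂ] H) * π a * star (U ζ : H →L[ℂ] H) = π (α ζ a)

attribute [instance] CovariantRep.normedAddCommGroup CovariantRep.innerProductSpace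
  CovariantRep.completeSpace

namespace CovariantRep

variable {α : CircleAction A} (ρ : CovariantRep α)

theorem continuous_integrand (f : C(Circle, A)) (ξ : ρ.H) :
    Continuous fun ζ : Circle => ρ.π (f ζ) ((ρ.U ζ : ρ.H →L[ℂ] ρ.H) ξ) := by
  have hπ : Continuous ρ.π :=
    AddMonoidHomClass.continuous_of_bound ρ.π 1 fun a => by
      simpa using NonUnitalStarAlgHom.norm_apply_le ρ.π a
  exact (hπ.comp f.continuous).clm_apply (ρ.continuous_U ξ)

theorem integrable_integrand (f : C(Circle, A)) (ξ : ρ.H) :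
    Integrable (fun ζ : Circle => ρ.π (f ζ) ((ρ.U ζ : ρ.H →L[ℂ] ρ.H) ξ)) haarCircle :=
  (ρ.continuous_integrand f ξ).integrable_of_hasCompactSupport
    (HasCompactSupport.of_compactSpace _)

theorem norm_integrand_le (f : C(Circle, A)) (ξ : ρ.H) (ζ : Circle) :
    ‖ρ.π (f ζ) ((ρ.U ζ : ρ.H →L[ℂ] ρ.H) ξ)‖ ≤ ‖f‖ * ‖ξ‖ := by
  have h1 : ‖ρ.π (f ζ)‖ ≤ ‖f‖ :=
    (NonUnitalStarAlgHom.norm_apply_le ρ.π (f ζ)).trans (f.norm_coe_le_norm ζ)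
  have h2 : ‖(ρ.U ζ : ρ.H →L[ℂ] ρ.H) ξ‖ ≤ ‖ξ‖ :=
    (ContinuousLinearMap.norm_map_of_mem_unitary (ρ.U ζ).2 ξ).le
  exact ContinuousLinearMap.le_of_opNorm_le_of_le _ h1 h2

/-- The integrated form `(π ⋊ U)(f) = ∫ π(f(ζ)) U_ζ dζ`, as a strong integral. -/
def integrated (f : C(Circle, A)) : ρ.H →L[ℂ] ρ.H :=
  LinearMap.mkContinuous
    { toFun := fun ξ => ∫ ζ, ρ.π (f ζ) ((ρ.U ζ : ρ.H →L[ℂ] ρ.H) ξ) ∂haarCircle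
      map_add' := fun ξ η => by
        simp only [map_add]
        exact integral_add (ρ.integrable_integrand f ξ) (ρ.integrable_integrand f η)
      map_smul' := fun c ξ => by
        simp only [map_smul, RingHom.id_apply]
        exact integral_smul c _ }
    ‖f‖ fun ξ => by
      simpa using norm_integral_le_of_norm_le_const (μ := haarCircle)
        (Filter.Eventually.of_forall (ρ.norm_integrand_le f ξ))

theorem norm_integrated_le (f : C(Circle, A)) : ‖ρ.integrated f‖ ≤ ‖f‖ :=
  LinearMap.mkContinuous_norm_le _ (norm_nonneg f) _

end CovariantRep

/-- The family of the integrated forms of `f ∈ C(𝕋, A)` in all covariant representations, as an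
element of the `ℓ^∞`-product of the algebras of bounded operators. Its norm is the universal norm
`‖f‖ = sup ‖(π ⋊ U)(f)‖`, the supremum over all covariant representations `(π, U)`. -/
def universalRep (α : CircleAction A) (f : C(Circle, A)) :
    lp (fun ρ : CovariantRep α => ρ.H →L[ℂ] ρ.H) ∞ :=
  ⟨fun ρ => ρ.integrated f, memℓp_infty ⟨‖f‖, by
    rintro _ ⟨ρ, rfl⟩
    exact ρ.norm_integrated_le f⟩⟩

/-- The (full) crossed product `A ⋊_α 𝕋`: the completion of `C(𝕋, A)` in the universal norm,
realized as the C⋆-algebra generated by the universal integrated forms of the elements of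
`C(𝕋, A)`. -/
def crossedProduct (α : CircleAction A) :
    NonUnitalStarSubalgebra ℂ (lp (fun ρ : CovariantRep α => ρ.H →L[ℂ] ρ.H) ∞) :=
  (NonUnitalStarAlgebra.adjoin ℂ (Set.range α.universalRep)).topologicalClosure

instance isClosed_crossedProduct (α : CircleAction A) :
    IsClosed (α.crossedProduct : Set (lp (fun ρ : CovariantRep α => ρ.H →L[ℂ] ρ.H) ∞)) :=
  NonUnitalStarSubalgebra.isClosed_topologicalClosure _

end

end CircleAction

/-!
Averaging an approximately equivariant unitary against `ζ⁻¹` and taking the polar part turns the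
Rokhlin property into exact eigenunitaries: there is a net of unitaries `v` with `α_ζ(v) = ζ v`
which asymptotically commute with every element of `A`. Multiplying the component of degree `n` by
`v⁻ⁿ` maps elements of bounded spectral support into `A^α`, asymptotically multiplicatively and
with norms growing at most linearly in the spectral bound. Given `a ≠ 0` in `A^α`, solve
`x a y = 1` in `A`; truncating to trigonometric polynomials and correcting by a Neumann series
makes the error decay geometrically against a linearly growing degree, so the solution can be
pushed into `A^α`.

For the crossed product, fix a single eigenunitary `v` and let `Pⱼ` be the spectral projections of
the unitaries implementing the action. The elements `vⁱ d v⁻ʲ Pⱼ` with `d ∈ A^α` behave like matrix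
units with coefficients in `A^α` and have dense span, so the crossed product is a copy of
`A^α ⊗ 𝒦`. A nonzero element has a nonzero matrix entry, and since `A^α` contains infinitely many
isometries with orthogonal ranges (it is not `ℂ`, as otherwise `v` would be central), every element
can be routed through that one entry. The copy is not zero because the GNS representation of an
invariant state has an invariant vector.
-/

/-! ### Fourier analysis on the circle -/

namespace CircleAction

instance isHaarMeasure_haarCircle : haarCircle.IsHaarMeasure :=
  inferInstanceAs (Measure.haarMeasure ⊤).IsHaarMeasure

theorem integrable_of_continuous {E : Type*} [NormedAddCommGroup E] {f : Circle → E}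
    (hf : Continuous f) : Integrable f haarCircle :=
  hf.integrable_of_hasCompactSupport (HasCompactSupport.of_compactSpace _)

theorem norm_integral_haarCircle_le {E : Type*} [NormedAddCommGroup E] [NormedSpace ℝ E]
    {f : Circle → E} {C : ℝ} (hf : ∀ ζ, ‖f ζ‖ ≤ C) : ‖∫ ζ, f ζ ∂haarCircle‖ ≤ C := by
  simpa using norm_integral_le_of_norm_le_const (μ := haarCircle) (.of_forall hf)

/-- The character `ζ ↦ ζ ^ n` of the circle. -/
noncomputable def character (n : ℤ) : C(Circle, ℂ) :=
  ⟨fun ζ => ((ζ ^ n : Circle) : ℂ), continuous_subtype_val.comp (continuous_zpow n)⟩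

@[simp]
theorem character_apply (n : ℤ) (ζ : Circle) : character n ζ = (ζ : ℂ) ^ n :=
  Circle.coe_zpow ζ n

@[fun_prop]
theorem continuous_coe_zpow (n : ℤ) : Continuous fun ζ : Circle => (ζ : ℂ) ^ n :=
  (character n).continuous.congr (character_apply n)

theorem norm_coe_zpow (ζ : Circle) (n : ℤ) : ‖(ζ : ℂ) ^ n‖ = 1 := by
  rw [norm_zpow, Circle.norm_coe, one_zpow]

theorem dense_span_character :
    Dense (Submodule.span ℂ (Set.range character) : Set C(Circle, ℂ)) := by
  have : Fact ((0 : ℝ) < 2 * Real.pi) := ⟨Real.two_pi_pos⟩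
  let e := AddCircle.homeomorphCircle Real.two_pi_pos.ne'
  let L := ContinuousMap.compRightAlgHom ℂ ℂ (e.symm : C(Circle, AddCircle (2 * Real.pi)))
  have surjective_L : Function.Surjective L := fun f =>
    ⟨f.comp e, ContinuousMap.ext fun ζ => congrArg f (e.apply_symm_apply ζ)⟩
  have L_fourier (n : ℤ) : L (fourier n) = character n := by
    ext ζ
    obtain ⟨t, rfl⟩ := e.surjective ζ
    change fourier n (e.symm (e t)) = _
    rw [e.symm_apply_apply, character_apply, AddCircle.homeomorphCircle_apply, fourier_apply,
      AddCircle.toCircle_zsmul, Circle.coe_zpow]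
  have dense_fourier := Submodule.dense_iff_topologicalClosure_eq_top.mpr
    (span_fourier_closure_eq_top (T := 2 * Real.pi))
  have dense_image := surjective_L.denseRange.dense_image
    (ContinuousMap.compRightAlgHom_continuous ℂ ℂ _) dense_fourier
  have image_span : L.toLinearMap '' (Submodule.span ℂ (Set.range (fourier (T := 2 * Real.pi))))
      = Submodule.span ℂ (Set.range character) := by
    rw [← Submodule.map_coe, Submodule.map_span, ← Set.range_comp]
    exact congrArg (fun φ => ((Submodule.span ℂ (Set.range φ) : Submodule ℂ C(Circle, ℂ)) :
      Set C(Circle, ℂ))) (funext L_fourier)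
  exact image_span ▸ dense_image

theorem integral_coe_zpow (n : ℤ) :
    ∫ ζ : Circle, (ζ : ℂ) ^ n ∂haarCircle = if n = 0 then 1 else 0 := by
  split_ifs with hn
  · simp [hn]
  · set η := Circle.exp (Real.pi / n) with hη
    have η_pow : (η : ℂ) ^ n = -1 := by
      rw [← Circle.coe_zpow, hη, ← Circle.exp_intCast_mul, mul_div_cancel₀ _ (by exact_mod_cast hn),
        Circle.coe_exp, Complex.exp_pi_mul_I]
    have invariant := integral_mul_left_eq_self (μ := haarCircle) (fun ζ : Circle => (ζ : ℂ) ^ n) η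
    simp only [Circle.coe_mul, mul_zpow, integral_const_mul, η_pow] at invariant
    linear_combination (-1 / 2 : ℂ) * invariant

theorem eq_zero_of_integral_zpow_mul_eq_zero {f : Circle → ℂ} (hf : Continuous f)
    (h : ∀ n : ℤ, ∫ ζ : Circle, (ζ : ℂ) ^ n * f ζ ∂haarCircle = 0) : f = 0 := by
  have integrable_mul (k : C(Circle, ℂ)) : Integrable (fun ζ => k ζ * f ζ) haarCircle :=
    integrable_of_continuous (by fun_prop)
  let L : C(Circle, ℂ) →L[ℂ] ℂ := LinearMap.mkContinuous
    { toFun := fun k => ∫ ζ : Circle, k ζ * f ζ ∂haarCircle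
      map_add' := fun k l => by
        simpa only [ContinuousMap.add_apply, add_mul] using
          integral_add (integrable_mul k) (integrable_mul l)
      map_smul' := fun c k => by
        simpa only [ContinuousMap.smul_apply, smul_eq_mul, mul_assoc, RingHom.id_apply] using
          integral_const_mul c _ }
    ‖(⟨f, hf⟩ : C(Circle, ℂ))‖ fun k => norm_integral_haarCircle_le fun ζ => by
      rw [norm_mul, mul_comm]
      gcongr
      · exact ContinuousMap.norm_coe_le_norm ⟨f, hf⟩ ζ
      · exact k.norm_coe_le_norm ζ
  have L_eq_zero : L = 0 := by
    refine ContinuousLinearMap.ext_on dense_span_character ?_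
    rintro - ⟨n, rfl⟩
    simpa [L] using h n
  have integral_sq : ∫ ζ, ‖f ζ‖ ^ 2 ∂haarCircle = 0 := by
    have := DFunLike.congr_fun L_eq_zero (star ⟨f, hf⟩)
    simp only [LinearMap.mkContinuous_apply, LinearMap.coe_mk, AddHom.coe_mk,
      ContinuousMap.star_apply, ContinuousMap.coe_mk, RCLike.star_def, Complex.conj_mul',
      zero_apply, L] at this
    exact_mod_cast this
  by_contra hf0
  obtain ⟨ζ, hζ⟩ := Function.ne_iff.mp hf0
  refine (Continuous.integral_pos_of_hasCompactSupport_nonneg_nonzero (μ := haarCircle) (x := ζ)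
    (f := fun ζ => ‖f ζ‖ ^ 2) (by fun_prop) (HasCompactSupport.of_compactSpace _)
    (fun ζ => by positivity) ?_).ne' integral_sq
  simpa using hζ

end CircleAction

/-! ### Isometric representations of the circle -/

theorem exists_dual_ne_zero_of_notMem_closure {𝕜 E : Type*} [RCLike 𝕜] [NormedAddCommGroup E]
    [NormedSpace 𝕜 E] {S : Submodule 𝕜 E} {x : E} (hx : x ∉ closure (S : Set E)) :
    ∃ f : E →L[𝕜] 𝕜, (∀ y ∈ S, f y = 0) ∧ f x ≠ 0 := by
  have : IsClosed (S.topologicalClosure : Set E) := S.isClosed_topologicalClosure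
  have mk_ne_zero : S.topologicalClosure.mkQL x ≠ 0 := by
    simpa [← SetLike.mem_coe, Submodule.topologicalClosure_coe] using hx
  obtain ⟨g, hg⟩ := SeparatingDual.exists_ne_zero (R := 𝕜) mk_ne_zero
  refine ⟨g.comp S.topologicalClosure.mkQL, fun y hy => ?_, hg⟩
  have mk_y : S.topologicalClosure.mkQL y = 0 := by
    simpa using S.le_topologicalClosure hy
  rw [ContinuousLinearMap.comp_apply, mk_y, map_zero]

/-- A strongly continuous isometric representation of the circle on a normed space. The
automorphisms of a circle action, the unitaries of a covariant representation and the translations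
of `C(Circle, A)` are all of this kind. -/
structure IsometricCircleRep (E : Type*) [NormedAddCommGroup E] [NormedSpace ℂ E] where
  toHom : Circle →* (E ≃ₗᵢ[ℂ] E)
  continuous_apply : ∀ x : E, Continuous fun ζ : Circle => toHom ζ x

namespace IsometricCircleRep

open CircleAction

variable {E : Type*} [NormedAddCommGroup E] [NormedSpace ℂ E] (T : IsometricCircleRep E)

noncomputable instance instCoeFun :
    CoeFun (IsometricCircleRep E) (fun _ => Circle → (E ≃ₗᵢ[ℂ] E)) :=
  ⟨fun T => T.toHom⟩

theorem mul_apply (ζ η : Circle) (x : E) : T (ζ * η) x = T ζ (T η x) := by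
  rw [map_mul]; rfl

/-- The isotypic component of `T` at the character `ζ ↦ ζ ^ n`. -/
def weightSpace (n : ℤ) : Submodule ℂ E where
  carrier := {x | ∀ ζ : Circle, T ζ x = (ζ : ℂ) ^ n • x}
  add_mem' hx hy ζ := by rw [map_add, hx ζ, hy ζ, smul_add]
  zero_mem' ζ := by simp
  smul_mem' c x hx ζ := by rw [map_smul, hx ζ, smul_comm]

theorem continuous_zpow_smul_apply (n : ℤ) (x : E) :
    Continuous fun ζ : Circle => (ζ : ℂ) ^ n • T ζ x :=
  (continuous_coe_zpow n).smul (T.continuous_apply x)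

theorem norm_zpow_smul_apply (n : ℤ) (x : E) (ζ : Circle) : ‖(ζ : ℂ) ^ n • T ζ x‖ = ‖x‖ := by
  rw [norm_smul, norm_coe_zpow, one_mul, LinearIsometryEquiv.norm_map]

/-- The projection `x ↦ ∫ ζ⁻ⁿ T_ζ x dζ` onto the isotypic component `T.weightSpace n`. -/
noncomputable def weightProj (n : ℤ) : E →L[ℂ] E :=
  LinearMap.mkContinuous
    { toFun := fun x => ∫ ζ : Circle, (ζ : ℂ) ^ (-n) • T ζ x ∂haarCircle
      map_add' := fun x y => by
        simp only [map_add, smul_add]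
        exact integral_add (integrable_of_continuous (T.continuous_zpow_smul_apply _ x))
          (integrable_of_continuous (T.continuous_zpow_smul_apply _ y))
      map_smul' := fun c x => by
        simp only [map_smul, smul_comm _ c, RingHom.id_apply]
        exact integral_smul c _ }
    1 fun x => by
      rw [one_mul]
      exact norm_integral_haarCircle_le fun ζ => (T.norm_zpow_smul_apply (-n) x ζ).le

theorem weightProj_apply (n : ℤ) (x : E) :
    T.weightProj n x = ∫ ζ : Circle, (ζ : ℂ) ^ (-n) • T ζ x ∂haarCircle :=
  rfl

theorem norm_weightProj_apply_le (n : ℤ) (x : E) : ‖T.weightProj n x‖ ≤ ‖x‖ :=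
  norm_integral_haarCircle_le fun ζ => (T.norm_zpow_smul_apply (-n) x ζ).le

theorem weightProj_apply_of_mem [CompleteSpace E] {m : ℤ} {x : E}
    (hx : x ∈ T.weightSpace m) (n : ℤ) :
    T.weightProj n x = if m = n then x else 0 := by
  have integrand (ζ : Circle) : (ζ : ℂ) ^ (-n) • T ζ x = (ζ : ℂ) ^ (m - n) • x := by
    rw [hx ζ, smul_smul, ← zpow_add₀ ζ.coe_ne_zero, neg_add_eq_sub]
  rw [weightProj_apply]
  simp only [integrand]
  rw [integral_smul_const, integral_coe_zpow]
  simp [sub_eq_zero]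

theorem weightProj_mem (n : ℤ) (x : E) : T.weightProj n x ∈ T.weightSpace n := by
  intro η
  have integrand (ζ : Circle) : T η ((ζ : ℂ) ^ (-n) • T ζ x) =
      (η : ℂ) ^ n • (((η * ζ : Circle) : ℂ) ^ (-n) • T (η * ζ) x) := by
    rw [map_smul, T.mul_apply, smul_smul, Circle.coe_mul, mul_zpow, ← mul_assoc,
      ← zpow_add₀ η.coe_ne_zero, add_neg_cancel, zpow_zero, one_mul]
  calc T η (T.weightProj n x)
      = ∫ ζ : Circle, T η ((ζ : ℂ) ^ (-n) • T ζ x) ∂haarCircle :=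
        ((T η).toContinuousLinearEquiv.integral_comp_comm _).symm
    _ = (η : ℂ) ^ n • T.weightProj n x := by
        simp only [integrand]
        rw [integral_smul, integral_mul_left_eq_self
          (fun ζ : Circle => (ζ : ℂ) ^ (-n) • T ζ x) η, weightProj_apply]

theorem weightProj_apply_apply (n : ℤ) (η : Circle) (x : E) :
    T.weightProj n (T η x) = (η : ℂ) ^ n • T.weightProj n x := by
  have integrand (ζ : Circle) : (ζ : ℂ) ^ (-n) • T ζ (T η x) =
      (η : ℂ) ^ n • (((ζ * η : Circle) : ℂ) ^ (-n) • T (ζ * η) x) := by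
    rw [T.mul_apply, smul_smul, Circle.coe_mul, mul_zpow, mul_left_comm,
      ← zpow_add₀ η.coe_ne_zero, add_neg_cancel, zpow_zero, mul_one]
  rw [weightProj_apply]
  simp only [integrand]
  rw [integral_smul, integral_mul_right_eq_self
    (fun ζ : Circle => (ζ : ℂ) ^ (-n) • T ζ x) η, weightProj_apply]

theorem norm_weightProj_sub_le [CompleteSpace E] {n : ℤ} {x : E} {ε : ℝ}
    (h : ∀ ζ : Circle, ‖T ζ x - (ζ : ℂ) ^ n • x‖ ≤ ε) : ‖T.weightProj n x - x‖ ≤ ε := by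
  have integral_sub_eq : T.weightProj n x - x =
      ∫ ζ : Circle, ((ζ : ℂ) ^ (-n) • T ζ x - x) ∂haarCircle := by
    rw [integral_sub (integrable_of_continuous (T.continuous_zpow_smul_apply _ _))
      (integrable_const _), ← weightProj_apply, integral_const, probReal_univ, one_smul]
  rw [integral_sub_eq]
  refine norm_integral_haarCircle_le fun ζ => ?_
  have factor : (ζ : ℂ) ^ (-n) • T ζ x - x = (ζ : ℂ) ^ (-n) • (T ζ x - (ζ : ℂ) ^ n • x) := by
    rw [smul_sub, smul_smul, ← zpow_add₀ ζ.coe_ne_zero, neg_add_cancel, zpow_zero, one_smul]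
  rw [factor, norm_smul, norm_coe_zpow, one_mul]
  exact h ζ

theorem dense_iSup_weightSpace [CompleteSpace E] :
    Dense ((⨆ n, T.weightSpace n : Submodule ℂ E) : Set E) := by
  intro x
  by_contra hx
  obtain ⟨f, f_eq_zero, f_x⟩ := exists_dual_ne_zero_of_notMem_closure hx
  have f_orbit : (fun ζ : Circle => f (T ζ x)) = 0 := by
    refine eq_zero_of_integral_zpow_mul_eq_zero (f.continuous.comp (T.continuous_apply x))
      fun n => ?_
    have f_weightProj := f_eq_zero _ (Submodule.mem_iSup_of_mem _ (T.weightProj_mem (-n) x))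
    rw [weightProj_apply, neg_neg, ← f.integral_comp_comm
      (integrable_of_continuous (T.continuous_zpow_smul_apply n x))] at f_weightProj
    simpa only [map_smul, smul_eq_mul] using f_weightProj
  exact f_x (by simpa using congrFun f_orbit 1)

end IsometricCircleRep

/-! ### Spectral subspaces -/

namespace CircleAction

variable {A : Type u} [CStarAlgebra A] (α : CircleAction A)

/-- The action `α`, seen as an isometric representation of the circle on the Banach space `A`. -/
noncomputable def toIsometricCircleRep : IsometricCircleRep A where
  toHom :=
    { toFun := fun ζ =>
        { (α ζ).toAlgEquiv.toLinearEquiv with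
          norm_map' := NonUnitalStarAlgHom.norm_map (α ζ) (α ζ).injective }
      map_one' := by ext a; exact DFunLike.congr_fun (map_one α.toHom) a
      map_mul' := fun ζ η => by ext a; exact DFunLike.congr_fun (map_mul α.toHom ζ η) a }
  continuous_apply := α.continuous_apply

/-- The spectral subspace `{a | α_ζ(a) = ζⁿ a for all ζ}` of `α`. -/
noncomputable abbrev spectralSubspace (n : ℤ) : Submodule ℂ A :=
  α.toIsometricCircleRep.weightSpace n

/-- The projection `a ↦ ∫ ζ⁻ⁿ α_ζ(a) dζ` of `A` onto the spectral subspace of index `n`. -/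
noncomputable abbrev spectralProj (n : ℤ) : A →L[ℂ] A :=
  α.toIsometricCircleRep.weightProj n

variable {α}

theorem mem_spectralSubspace {n : ℤ} {a : A} :
    a ∈ α.spectralSubspace n ↔ ∀ ζ : Circle, α ζ a = (ζ : ℂ) ^ n • a :=
  Iff.rfl

theorem mul_mem_spectralSubspace {m n : ℤ} {a b : A} (ha : a ∈ α.spectralSubspace m)
    (hb : b ∈ α.spectralSubspace n) : a * b ∈ α.spectralSubspace (m + n) :=
  mem_spectralSubspace.mpr fun ζ => by
    rw [map_mul, mem_spectralSubspace.mp ha ζ, mem_spectralSubspace.mp hb ζ, smul_mul_smul_comm,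
      zpow_add₀ ζ.coe_ne_zero]

theorem star_mem_spectralSubspace {n : ℤ} {a : A} (ha : a ∈ α.spectralSubspace n) :
    star a ∈ α.spectralSubspace (-n) :=
  mem_spectralSubspace.mpr fun ζ => by
    rw [map_star, mem_spectralSubspace.mp ha ζ, star_smul, star_zpow₀, zpow_neg, ← inv_zpow,
      ← Circle.coe_inv, Circle.coe_inv_eq_conj, RCLike.star_def]

theorem mem_spectralSubspace_zero {a : A} : a ∈ α.spectralSubspace 0 ↔ a ∈ α.fixedPoints := by
  simp only [mem_spectralSubspace, zpow_zero, one_smul]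
  rfl

theorem one_mem_spectralSubspace_zero : (1 : A) ∈ α.spectralSubspace 0 :=
  mem_spectralSubspace_zero.mpr (one_mem _)

theorem spectralProj_one : α.spectralProj 0 1 = 1 := by
  rw [IsometricCircleRep.weightProj_apply_of_mem _ one_mem_spectralSubspace_zero, if_pos rfl]

theorem spectralProj_mul_left {a : A} (ha : a ∈ α.fixedPoints) (n : ℤ) (x : A) :
    α.spectralProj n (a * x) = a * α.spectralProj n x := by
  have integrand (ζ : Circle) :
      (ζ : ℂ) ^ (-n) • α ζ (a * x) = a * ((ζ : ℂ) ^ (-n) • α ζ x) := by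
    rw [map_mul, ha ζ, mul_smul_comm]
  calc α.spectralProj n (a * x) = ∫ ζ : Circle, a * ((ζ : ℂ) ^ (-n) • α ζ x) ∂haarCircle :=
        integral_congr_ae (.of_forall integrand)
    _ = a * α.spectralProj n x := (ContinuousLinearMap.mul ℂ A a).integral_comp_comm
        (integrable_of_continuous (α.toIsometricCircleRep.continuous_zpow_smul_apply _ x))

variable (α) in
/-- The elements of `A` with spectral support in `[-N, N]`: the `A`-valued analogues of the
trigonometric polynomials of degree at most `N`. -/
noncomputable def spectralFiltration (N : ℕ) : Submodule ℂ A :=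
  ⨆ n : Set.Icc (-N : ℤ) N, α.spectralSubspace n

theorem spectralSubspace_le_spectralFiltration {n : ℤ} {N : ℕ} (hn : |n| ≤ N) :
    α.spectralSubspace n ≤ α.spectralFiltration N :=
  le_iSup (fun n : Set.Icc (-N : ℤ) N => α.spectralSubspace n) ⟨n, abs_le.mp hn⟩

theorem monotone_spectralFiltration : Monotone α.spectralFiltration := fun M N hMN =>
  iSup_le fun n => spectralSubspace_le_spectralFiltration
    ((abs_le.mpr n.2).trans (by exact_mod_cast hMN))

theorem one_mem_spectralFiltration (N : ℕ) : (1 : A) ∈ α.spectralFiltration N :=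
  spectralSubspace_le_spectralFiltration (by simp) one_mem_spectralSubspace_zero

theorem mul_mem_spectralFiltration {M N : ℕ} {x y : A} (hx : x ∈ α.spectralFiltration M)
    (hy : y ∈ α.spectralFiltration N) : x * y ∈ α.spectralFiltration (M + N) := by
  have mul_le : α.spectralFiltration M * α.spectralFiltration N ≤
      α.spectralFiltration (M + N) := by
    simp only [spectralFiltration, Submodule.iSup_mul, Submodule.mul_iSup]
    refine iSup_le fun n => iSup_le fun m => Submodule.mul_le.mpr fun a ha b hb =>
      spectralSubspace_le_spectralFiltration ?_ (mul_mem_spectralSubspace ha hb)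
    push_cast
    exact (abs_add_le _ _).trans (add_le_add (abs_le.mpr m.2) (abs_le.mpr n.2))
  exact mul_le (Submodule.mul_mem_mul hx hy)

theorem pow_mem_spectralFiltration {N : ℕ} {x : A} (hx : x ∈ α.spectralFiltration N) (k : ℕ) :
    x ^ k ∈ α.spectralFiltration (k * N) := by
  induction k with
  | zero => simpa using one_mem_spectralFiltration 0
  | succ k ih => simpa only [pow_succ, Nat.succ_mul] using mul_mem_spectralFiltration ih hx

theorem exists_mem_spectralFiltration {x : A} (hx : x ∈ ⨆ n, α.spectralSubspace n) :
    ∃ N, x ∈ α.spectralFiltration N := by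
  rw [← Submodule.mem_iSup_of_directed _ monotone_spectralFiltration.directed_le]
  refine (iSup_le fun n => ?_ : ⨆ n, α.spectralSubspace n ≤ _) hx
  exact (spectralSubspace_le_spectralFiltration (N := n.natAbs) (by simp)).trans (le_iSup _ _)

end CircleAction

section PolarPart

variable {C : Type*} [CStarAlgebra C]

/-- The polar part `z |z|⁻¹`, where `|z| = (z⋆z)^(1/2)`. It is only meaningful when `|z|` is
invertible. -/
noncomputable def polarPart (z : C) : C :=
  z * cfc (fun x : ℝ => (√x)⁻¹) (star z * z)

variable {z : C}

theorem pos_of_mem_spectrum_star_mul_self (hz : IsUnit (star z * z)) {x : ℝ}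
    (hx : x ∈ spectrum ℝ (star z * z)) : 0 < x :=
  (spectrum_star_mul_self_nonneg x hx).lt_of_ne' fun h =>
    spectrum.zero_notMem ℝ hz (h ▸ hx)

theorem continuousOn_inv_sqrt_spectrum (hz : IsUnit (star z * z)) :
    ContinuousOn (fun x : ℝ => (√x)⁻¹) (spectrum ℝ (star z * z)) :=
  Real.continuous_sqrt.continuousOn.inv₀ fun _ hx =>
    (Real.sqrt_pos.mpr (pos_of_mem_spectrum_star_mul_self hz hx)).ne'

theorem star_polarPart_mul_self (hz : IsUnit (star z * z)) :
    star (polarPart z) * polarPart z = 1 := by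
  set h := star z * z
  have cont := continuousOn_inv_sqrt_spectrum hz
  have star_inv : star (cfc (fun x : ℝ => (√x)⁻¹) h) = cfc (fun x : ℝ => (√x)⁻¹) h :=
    (cfc_predicate (fun x : ℝ => (√x)⁻¹) h).star_eq
  calc star (polarPart z) * polarPart z
      = cfc (fun x : ℝ => (√x)⁻¹) h * cfc (fun x : ℝ => x) h * cfc (fun x : ℝ => (√x)⁻¹) h := by
        rw [cfc_id' ℝ h, polarPart, star_mul, star_inv]
        simp only [h, mul_assoc]
    _ = cfc (fun x : ℝ => (√x)⁻¹ * x * (√x)⁻¹) h := by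
        rw [← cfc_mul _ _ h cont, ← cfc_mul (fun x : ℝ => (√x)⁻¹ * x) _ h
          (cont.mul (continuousOn_id' _)) cont]
    _ = cfc (fun _ : ℝ => (1 : ℝ)) h := cfc_congr fun x hx => by
        have hx0 := pos_of_mem_spectrum_star_mul_self hz hx
        have := (Real.sqrt_pos.mpr hx0).ne'
        field_simp
        exact (Real.sq_sqrt hx0.le).symm
    _ = 1 := cfc_const_one ℝ h

theorem polarPart_mul_cfc_sqrt (hz : IsUnit (star z * z)) :
    polarPart z * cfc Real.sqrt (star z * z) = z := by
  rw [polarPart, mul_assoc, ← cfc_mul _ _ _ (continuousOn_inv_sqrt_spectrum hz),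
    cfc_congr (g := fun _ => (1 : ℝ)) fun x hx => inv_mul_cancel₀
      (Real.sqrt_pos.mpr (pos_of_mem_spectrum_star_mul_self hz hx)).ne',
    cfc_const_one ℝ _, mul_one]

theorem norm_cfc_sqrt_sub_one_le (z : C) :
    ‖cfc Real.sqrt (star z * z) - 1‖ ≤ ‖star z * z - 1‖ := by
  nontriviality C
  nth_rw 1 [← cfc_const_one ℝ (star z * z)]
  rw [← cfc_sub _ _ _]
  refine norm_cfc_le (norm_nonneg _) fun x hx => ?_
  have hx0 : 0 ≤ x := spectrum_star_mul_self_nonneg x hx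
  have mem_spectrum_sub : x - 1 ∈ spectrum ℝ (star z * z - 1) := by
    rw [← map_one (algebraMap ℝ C), ← spectrum.sub_singleton_eq]
    exact Set.sub_mem_sub hx rfl
  calc ‖√x - 1‖ ≤ ‖√x - 1‖ * (√x + 1) := le_mul_of_one_le_right (norm_nonneg _) (by simp)
    _ = ‖x - 1‖ := by
        rw [← Real.norm_of_nonneg (by positivity : 0 ≤ √x + 1), ← norm_mul]
        congr 1
        linear_combination Real.sq_sqrt hx0
    _ ≤ ‖star z * z - 1‖ := by
        simpa using spectrum.norm_le_norm_of_mem mem_spectrum_sub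

theorem polarPart_mem_unitary (hz : IsUnit z) : polarPart z ∈ unitary C := by
  have h := star_polarPart_mul_self (hz.star.mul hz)
  refine IsUnit.mem_unitary_of_star_mul_self ?_ h
  refine isUnit_iff_exists_and_exists.mpr ⟨⟨cfc Real.sqrt (star z * z) * ↑hz.unit⁻¹, ?_⟩,
    star (polarPart z), h⟩
  rw [← mul_assoc, polarPart_mul_cfc_sqrt (hz.star.mul hz), IsUnit.mul_val_inv]

theorem norm_polarPart_sub_le {u : C} (hz : IsUnit z) (hz1 : ‖z‖ ≤ 1) (hu : u ∈ unitary C) :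
    ‖polarPart z - u‖ ≤ 3 * ‖z - u‖ := by
  have norm_polarPart_sub : ‖polarPart z - z‖ ≤ ‖star z * z - 1‖ := by
    nth_rw 2 [← polarPart_mul_cfc_sqrt (hz.star.mul hz)]
    rw [← mul_one_sub, CStarRing.norm_mem_unitary_mul _ (polarPart_mem_unitary hz), norm_sub_rev]
    exact norm_cfc_sqrt_sub_one_le z
  have norm_star_mul_self_sub : ‖star z * z - 1‖ ≤ 2 * ‖z - u‖ :=
    calc ‖star z * z - 1‖ = ‖star z * (z - u) + star (z - u) * u‖ := by
          rw [← Unitary.star_mul_self_of_mem hu, star_sub]; noncomm_ring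
      _ ≤ ‖star z‖ * ‖z - u‖ + ‖star (z - u)‖ := by
          refine (norm_add_le _ _).trans (add_le_add (norm_mul_le _ _) ?_)
          rw [CStarRing.norm_mul_mem_unitary _ hu]
      _ ≤ 2 * ‖z - u‖ := by
          rw [norm_star, norm_star]
          linarith [mul_le_of_le_one_left (norm_nonneg (z - u)) hz1]
  linarith [norm_sub_le_norm_sub_add_norm_sub (polarPart z) z u]

theorem map_polarPart {C' : Type*} [CStarAlgebra C'] (φ : C ≃⋆ₐ[ℂ] C') (hz : IsUnit (star z * z)) :
    φ (polarPart z) = polarPart (φ z) := by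
  rw [polarPart, polarPart, ← map_star, ← map_mul, map_mul φ z]
  congr 1
  exact StarAlgHomClass.map_cfc φ _ _ (continuousOn_inv_sqrt_spectrum hz)
    (AddMonoidHomClass.continuous_of_bound φ 1 fun a => by
      simpa using NonUnitalStarAlgHom.norm_apply_le φ a)
    (IsSelfAdjoint.star_mul_self z) ((IsSelfAdjoint.star_mul_self z).map φ)

theorem polarPart_smul (c : Circle) (z : C) : polarPart ((c : ℂ) • z) = (c : ℂ) • polarPart z := by
  rw [polarPart, polarPart, smul_mul_assoc, star_smul, smul_mul_smul_comm]
  have star_mul_self : star (c : ℂ) * c = 1 := by simp [Complex.conj_mul', Circle.norm_coe]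
  rw [star_mul_self, one_smul]

end PolarPart

/-! ### Eigenunitaries -/

section AsymptoticallyCentral

open Filter Topology

variable {ι : Type*}

/-- The families of unitaries that asymptotically commute with every element of `A` along the
filter `l`. -/
def asymptoticallyCentral (A : Type*) [CStarAlgebra A] (l : Filter ι) :
    Subgroup (ι → unitary A) where
  carrier := {v | ∀ a : A, Tendsto (fun i => (v i : A) * a - a * v i) l (𝓝 0)}
  one_mem' a := by simp [tendsto_const_nhds]
  mul_mem' {v w} hv hw a := by
    have norm_le (i : ι) : ‖((v i * w i : unitary A) : A) * a - a * (v i * w i : unitary A)‖ ≤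
        ‖(w i : A) * a - a * w i‖ + ‖(v i : A) * a - a * v i‖ := by
      calc ‖((v i * w i : unitary A) : A) * a - a * (v i * w i : unitary A)‖
          = ‖(v i : A) * (w i * a - a * w i) + (v i * a - a * v i) * w i‖ := by
            rw [Submonoid.coe_mul]; noncomm_ring
        _ ≤ _ := (norm_add_le _ _).trans_eq (by
            rw [CStarRing.norm_coe_unitary_mul, CStarRing.norm_mul_coe_unitary])
    exact squeeze_zero_norm norm_le (by simpa using (hw a).norm.add (hv a).norm)
  inv_mem' {v} hv a := by
    have norm_eq (i : ι) : ‖(((v i)⁻¹ : unitary A) : A) * a - a * ((v i)⁻¹ : unitary A)‖ =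
        ‖(v i : A) * a - a * v i‖ := by
      calc ‖(((v i)⁻¹ : unitary A) : A) * a - a * ((v i)⁻¹ : unitary A)‖
          = ‖(((v i)⁻¹ : unitary A) : A) * (a * v i - v i * a) * ((v i)⁻¹ : unitary A)‖ := by
            rw [mul_sub, sub_mul, mul_assoc, mul_assoc a, ← Submonoid.coe_mul, ← mul_assoc _ _ a,
              ← Submonoid.coe_mul, mul_inv_cancel, inv_mul_cancel]
            simp
        _ = ‖(v i : A) * a - a * v i‖ := by
            rw [CStarRing.norm_mul_coe_unitary, CStarRing.norm_coe_unitary_mul, norm_sub_rev]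
    exact squeeze_zero_norm (fun i => (norm_eq i).le) (by simpa using (hv a).norm)

end AsymptoticallyCentral

namespace CircleAction

open Filter Topology

variable {A : Type u} [CStarAlgebra A] {α : CircleAction A}

variable (α) in
/-- The unitaries `v` with `α_ζ(v) = ζ v` for all `ζ`: exact solutions of the equation that the
Rokhlin property only solves approximately. -/
def eigenunitaries : Set (unitary A) := {v | (v : A) ∈ α.spectralSubspace 1}

theorem zpow_mem_spectralSubspace {v : unitary A} (hv : v ∈ α.eigenunitaries) (n : ℤ) :
    ((v ^ n : unitary A) : A) ∈ α.spectralSubspace n := by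
  have pow_mem (n : ℕ) : ((v ^ n : unitary A) : A) ∈ α.spectralSubspace n := by
    induction n with
    | zero => simpa using one_mem_spectralSubspace_zero
    | succ n ih =>
      rw [pow_succ]
      exact_mod_cast mul_mem_spectralSubspace ih hv
  cases n with
  | ofNat n => simpa using pow_mem n
  | negSucc n =>
    rw [zpow_negSucc, ← Unitary.star_eq_inv, Unitary.coe_star]
    exact star_mem_spectralSubspace (pow_mem (n + 1))

theorem exists_eigenunitary_near [Nontrivial A] {u : A} (hu : u ∈ unitary A) {ε : ℝ}
    (hε : ε < 1) (h : ∀ ζ : Circle, ‖α ζ u - (ζ : ℂ) • u‖ ≤ ε) :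
    ∃ v ∈ α.eigenunitaries, ‖(v : A) - u‖ ≤ 3 * ε := by
  set w := α.spectralProj 1 u
  have w_near : ‖w - u‖ ≤ ε :=
    α.toIsometricCircleRep.norm_weightProj_sub_le fun ζ => by rw [zpow_one]; exact h ζ
  have norm_w : ‖w‖ ≤ 1 :=
    (α.toIsometricCircleRep.norm_weightProj_apply_le 1 u).trans_eq
      (CStarRing.norm_of_mem_unitary hu)
  have isUnit_w : IsUnit w := by
    have isUnit_star_mul : IsUnit (star u * w) := by
      rw [← sub_sub_cancel 1 (star u * w)]
      refine isUnit_one_sub_of_norm_lt_one (lt_of_eq_of_lt ?_ (w_near.trans_lt hε))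
      rw [← Unitary.star_mul_self_of_mem hu, ← mul_sub,
        CStarRing.norm_mem_unitary_mul _ (Unitary.star_mem hu), norm_sub_rev]
    rw [← one_mul w, ← Unitary.mul_star_self_of_mem hu, mul_assoc]
    exact (Unitary.isUnit_coe (U := ⟨u, hu⟩)).mul isUnit_star_mul
  refine ⟨⟨polarPart w, polarPart_mem_unitary isUnit_w⟩, fun ζ => ?_,
    (norm_polarPart_sub_le isUnit_w norm_w hu).trans (by gcongr)⟩
  calc α ζ (polarPart w) = polarPart (α ζ w) := map_polarPart _ (isUnit_w.star.mul isUnit_w)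
    _ = polarPart ((ζ : ℂ) • w) := by
        rw [mem_spectralSubspace.mp (α.toIsometricCircleRep.weightProj_mem 1 u) ζ, zpow_one]
    _ = (ζ : ℂ) ^ (1 : ℤ) • polarPart w := by rw [polarPart_smul, zpow_one]

theorem HasRokhlinProperty.exists_asymptoticallyCentral [Nontrivial A]
    (hα : α.HasRokhlinProperty) :
    ∃ v : Finset A × ℕ → unitary A, (∀ i, v i ∈ α.eigenunitaries) ∧
      v ∈ asymptoticallyCentral A atTop := by
  let ε (i : Finset A × ℕ) : ℝ := 1 / ((i.2 + 1 : ℕ) + 1)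
  have ε_pos (i) : 0 < ε i := by positivity
  have ε_lt_one (i) : ε i < 1 := by
    rw [div_lt_one (by positivity)]; push_cast; linarith [Nat.cast_nonneg (α := ℝ) i.2]
  have tendsto_ε : Tendsto ε atTop (𝓝 0) := by
    rw [← prod_atTop_atTop_eq]
    exact (tendsto_one_div_add_atTop_nhds_zero_nat.comp (tendsto_add_atTop_nat 1)).comp tendsto_snd
  choose u u_mem u_eigen u_comm using fun i => hα (ε i) (ε_pos i) i.1
  choose v v_mem v_near using fun i =>
    exists_eigenunitary_near (u_mem i) (ε_lt_one i) fun ζ => (u_eigen i ζ).le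
  refine ⟨v, v_mem, fun a => ?_⟩
  have tendsto_sub : Tendsto (fun i => (v i : A) - u i) atTop (𝓝 0) :=
    squeeze_zero_norm v_near (by simpa using tendsto_ε.const_mul 3)
  have tendsto_comm : Tendsto (fun i => u i * a - a * u i) atTop (𝓝 0) := by
    refine squeeze_zero_norm' ?_ tendsto_ε
    filter_upwards [eventually_ge_atTop ({a}, 0)] with i hi
    exact (u_comm i a (hi.1 (Finset.mem_singleton_self a))).le
  have tendsto_add := tendsto_comm.add ((tendsto_sub.mul_const a).sub (tendsto_sub.const_mul a))
  simp only [zero_mul, mul_zero, sub_zero, add_zero] at tendsto_add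
  exact tendsto_add.congr fun i => by noncomm_ring

variable (α) in
/-- Multiplies the component of `x` of spectral degree `n` by `v⁻ⁿ`, for `|n| ≤ N`. When `v` is an
eigenunitary this replaces every component by a fixed element. -/
noncomputable def twist (v : unitary A) (N : ℕ) : A →ₗ[ℂ] A :=
  ∑ n ∈ Finset.Icc (-N : ℤ) N,
    LinearMap.mulRight ℂ ((v ^ (-n) : unitary A) : A) ∘ₗ (α.spectralProj n : A →ₗ[ℂ] A)

variable {v : unitary A} {N : ℕ}

theorem twist_apply (x : A) : α.twist v N x =
    ∑ n ∈ Finset.Icc (-N : ℤ) N, α.spectralProj n x * ((v ^ (-n) : unitary A) : A) := by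
  simp [twist]

theorem twist_apply_of_mem {n : ℤ} (hn : |n| ≤ N) {x : A} (hx : x ∈ α.spectralSubspace n) :
    α.twist v N x = x * ((v ^ (-n) : unitary A) : A) := by
  rw [twist_apply,
    Finset.sum_eq_single_of_mem n (Finset.mem_Icc.mpr (abs_le.mp hn)) fun k _ hk => ?_,
    IsometricCircleRep.weightProj_apply_of_mem _ hx, if_pos rfl]
  rw [IsometricCircleRep.weightProj_apply_of_mem _ hx, if_neg hk.symm, zero_mul]

theorem twist_one : α.twist v N 1 = 1 := by
  rw [twist_apply_of_mem (by simp) one_mem_spectralSubspace_zero]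
  simp

theorem twist_mul_left {a : A} (ha : a ∈ α.fixedPoints) (x : A) :
    α.twist v N (a * x) = a * α.twist v N x := by
  simp only [twist_apply, spectralProj_mul_left ha, Finset.mul_sum, mul_assoc]

theorem twist_mem_fixedPoints (hv : v ∈ α.eigenunitaries) (x : A) :
    α.twist v N x ∈ α.fixedPoints := by
  rw [twist_apply]
  refine sum_mem fun n _ => mem_spectralSubspace_zero.mp ?_
  simpa only [add_neg_cancel] using mul_mem_spectralSubspace
    (α.toIsometricCircleRep.weightProj_mem n x) (zpow_mem_spectralSubspace hv (-n))

theorem norm_twist_le (x : A) : ‖α.twist v N x‖ ≤ (2 * N + 1) * ‖x‖ := by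
  rw [twist_apply]
  refine (norm_sum_le_of_le _ fun n _ => ?_).trans_eq (b := ∑ _n ∈ Finset.Icc (-N : ℤ) N, ‖x‖) ?_
  · rw [CStarRing.norm_mul_coe_unitary]
    exact α.toIsometricCircleRep.norm_weightProj_apply_le n x
  · have card : ((N : ℤ) + 1 - -N).toNat = 2 * N + 1 := by omega
    rw [Finset.sum_const, Int.card_Icc, card, nsmul_eq_mul]
    push_cast
    rfl

theorem tendsto_twist_mul_sub {ι : Type*} {l : Filter ι} {v : ι → unitary A}
    (hv : v ∈ asymptoticallyCentral A l) {K : ℕ} (hKN : 2 * K ≤ N) {x y : A}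
    (hx : x ∈ α.spectralFiltration K) (hy : y ∈ α.spectralFiltration K) :
    Tendsto (fun i => α.twist (v i) N (x * y) - α.twist (v i) N x * α.twist (v i) N y)
      l (𝓝 0) := by
  induction hx using Submodule.iSup_induction' with
  | zero => simp [tendsto_const_nhds]
  | add x₁ x₂ _ _ ih₁ ih₂ =>
    simpa only [add_mul, map_add, add_sub_add_comm, add_zero] using ih₁.add ih₂
  | mem m a ha =>
    induction hy using Submodule.iSup_induction' with
    | zero => simp [tendsto_const_nhds]
    | add y₁ y₂ _ _ ih₁ ih₂ =>
      simpa only [mul_add, map_add, add_sub_add_comm, add_zero] using ih₁.add ih₂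
    | mem n b hb =>
      have hm := abs_le.mpr m.2
      have hn := abs_le.mpr n.2
      have twist_comm (i : ι) : α.twist (v i) N (a * b) - α.twist (v i) N a * α.twist (v i) N b =
          -(a * ((((v ^ (-m : ℤ)) i : A) * b - b * (v ^ (-m : ℤ)) i) *
            ((v i ^ (-n : ℤ) : unitary A) : A))) := by
        rw [twist_apply_of_mem ((abs_add_le _ _).trans (by omega)) (mul_mem_spectralSubspace ha hb),
          twist_apply_of_mem (hm.trans (by omega)) ha, twist_apply_of_mem (hn.trans (by omega)) hb,
          neg_add, zpow_add, Submonoid.coe_mul, Pi.pow_apply]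
        noncomm_ring
      refine squeeze_zero_norm (fun i => (?_ : _ ≤ ‖a‖ *
        ‖((v ^ (-m : ℤ)) i : A) * b - b * (v ^ (-m : ℤ)) i‖)) ?_
      · rw [twist_comm, norm_neg]
        exact (norm_mul_le _ _).trans_eq (by rw [CStarRing.norm_mul_coe_unitary])
      · simpa using ((zpow_mem hv (-m : ℤ)) b).norm.const_mul ‖a‖

end CircleAction

/-! ### The fixed point algebra -/

theorem isPurelyInfiniteSimple_of_forall {B : Type*} [NonUnitalCStarAlgebra B] [Nontrivial B]
    (h : ∀ a b : B, a ≠ 0 → ∃ x y : B, x * a * y = b) : IsPurelyInfiniteSimple B := by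
  refine ⟨⟨inferInstance, fun I _ => ?_⟩, h⟩
  by_cases hI : ∃ a ∈ I, a ≠ 0
  · obtain ⟨a, a_mem, a_ne_zero⟩ := hI
    refine Or.inr (eq_top_iff.mpr fun b _ => ?_)
    obtain ⟨x, y, rfl⟩ := h a b a_ne_zero
    exact I.mul_mem_right _ _ (I.mul_mem_left _ _ a_mem)
  · push Not at hI
    refine Or.inl (eq_bot_iff.mpr fun b hb => ?_)
    rw [hI b hb]
    exact zero_mem _

namespace CircleAction

open Filter Topology

variable {A : Type u} [CStarAlgebra A] {α : CircleAction A}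

theorem fixed_mul_mem_spectralFiltration {N : ℕ} {a x : A} (ha : a ∈ α.fixedPoints)
    (hx : x ∈ α.spectralFiltration N) : a * x ∈ α.spectralFiltration N := by
  simpa using mul_mem_spectralFiltration (spectralSubspace_le_spectralFiltration (N := 0)
    (by simp) (mem_spectralSubspace_zero.mpr ha)) hx

theorem exists_spectralFiltration_mul_mul_near_one {a x y : A} (h : x * a * y = 1) :
    ∃ L, ∃ x' ∈ α.spectralFiltration L, ∃ y' ∈ α.spectralFiltration L,
      ‖1 - x' * a * y'‖ < 1 / 2 := by
  have dense := α.toIsometricCircleRep.dense_iSup_weightSpace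
  have isOpen_near : IsOpen {p : A × A | ‖1 - p.1 * a * p.2‖ < 1 / 2} :=
    isOpen_lt (by fun_prop) continuous_const
  obtain ⟨⟨x', y'⟩, near, x'_mem, y'_mem⟩ :=
    (dense.prod dense).inter_open_nonempty _ isOpen_near ⟨(x, y), by simp [h]⟩
  obtain ⟨M, hM⟩ := exists_mem_spectralFiltration x'_mem
  obtain ⟨N, hN⟩ := exists_mem_spectralFiltration y'_mem
  exact ⟨max M N, x', monotone_spectralFiltration (le_max_left M N) hM, y',
    monotone_spectralFiltration (le_max_right M N) hN, near⟩

theorem exists_spectralFiltration_mul_norm_one_sub_lt_one {a x y : A} (ha : a ∈ α.fixedPoints)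
    (h : x * a * y = 1) :
    ∃ M : ℕ, ∃ x' ∈ α.spectralFiltration M, ∃ y' ∈ α.spectralFiltration M,
      (2 * (2 * M : ℕ) + 1) * ‖1 - x' * (a * y')‖ < 1 := by
  obtain ⟨L, x₀, hx₀, y₀, hy₀, near⟩ := exists_spectralFiltration_mul_mul_near_one (α := α) h
  set w := 1 - x₀ * a * y₀ with hw
  have w_mem : w ∈ α.spectralFiltration (L + L) := by
    rw [hw, mul_assoc]
    exact sub_mem (one_mem_spectralFiltration _) (mul_mem_spectralFiltration hx₀
      (fixed_mul_mem_spectralFiltration ha hy₀))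
  -- The `K`-th partial sum of the Neumann series turns the error `w` into `w ^ K`, at the cost of a
  -- spectral support that grows only linearly in `K`.
  have neumann (K : ℕ) : 1 - (∑ k ∈ Finset.range K, w ^ k) * x₀ * (a * y₀) = w ^ K := by
    rw [mul_assoc, ← mul_assoc x₀, ← sub_sub_cancel 1 (x₀ * a * y₀), ← hw, geom_sum_mul_neg,
      sub_sub_cancel]
  have sum_mem (K : ℕ) : (∑ k ∈ Finset.range K, w ^ k) * x₀ ∈
      α.spectralFiltration (K * (L + L) + L) :=
    mul_mem_spectralFiltration (sum_mem fun k hk => monotone_spectralFiltration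
      (Nat.mul_le_mul_right _ (Finset.mem_range.mp hk).le) (pow_mem_spectralFiltration w_mem k)) hx₀
  have tendsto_bound : Tendsto (fun K : ℕ =>
      (2 * (2 * (K * (L + L) + L) : ℕ) + 1 : ℝ) * (1 / 2) ^ K) atTop (𝓝 0) := by
    have h1 := (tendsto_self_mul_const_pow_of_lt_one (r := (1 / 2 : ℝ)) (by norm_num)
      (by norm_num)).const_mul (8 * L : ℝ)
    have h2 := (tendsto_pow_atTop_nhds_zero_of_lt_one (r := (1 / 2 : ℝ)) (by norm_num)
      (by norm_num)).const_mul (4 * L + 1 : ℝ)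
    have h12 := h1.add h2
    rw [mul_zero, mul_zero, add_zero] at h12
    refine h12.congr fun K => ?_
    push_cast
    ring
  obtain ⟨K, hK, K_pos⟩ := ((tendsto_bound.eventually (gt_mem_nhds one_pos)).and
    (eventually_gt_atTop 0)).exists
  refine ⟨K * (L + L) + L, _, sum_mem K, y₀, monotone_spectralFiltration (by omega) hy₀,
    lt_of_le_of_lt ?_ hK⟩
  rw [neumann]
  gcongr
  exact (norm_pow_le' _ K_pos).trans (pow_le_pow_left₀ (norm_nonneg _) near.le K)

theorem HasRokhlinProperty.exists_mul_mul_eq_one (hα : α.HasRokhlinProperty)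
    (hA : IsPurelyInfiniteSimple A) {a : α.fixedPoints} (ha : a ≠ 0) :
    ∃ x y : α.fixedPoints, x * a * y = 1 := by
  classical
  have : Nontrivial A := hA.1.1
  obtain ⟨x, y, hxy⟩ := hA.2 (a : A) 1 fun h => ha (Subtype.ext h)
  obtain ⟨M, x', hx', y', hy', near⟩ := exists_spectralFiltration_mul_norm_one_sub_lt_one a.2 hxy
  obtain ⟨v, v_eigen, v_central⟩ := hα.exists_asymptoticallyCentral
  have tendsto_mul := tendsto_twist_mul_sub v_central (N := 2 * M) le_rfl hx'
    (fixed_mul_mem_spectralFiltration a.2 hy')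
  obtain ⟨i, hi⟩ := (tendsto_mul.norm.eventually
    (gt_mem_nhds (norm_zero.trans_lt (sub_pos.mpr near)))).exists
  let X : α.fixedPoints := ⟨α.twist (v i) (2 * M) x', twist_mem_fixedPoints (v_eigen i) x'⟩
  let Y : α.fixedPoints := ⟨α.twist (v i) (2 * M) y', twist_mem_fixedPoints (v_eigen i) y'⟩
  have norm_lt_one : ‖1 - X * a * Y‖ < 1 := by
    have split : (1 : A) - α.twist (v i) (2 * M) x' * α.twist (v i) (2 * M) (a * y') =
        α.twist (v i) (2 * M) (1 - x' * (a * y')) + (α.twist (v i) (2 * M) (x' * (a * y')) -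
          α.twist (v i) (2 * M) x' * α.twist (v i) (2 * M) (a * y')) := by
      rw [map_sub, twist_one]; abel
    calc ‖1 - X * a * Y‖
        = ‖(1 : A) - α.twist (v i) (2 * M) x' * α.twist (v i) (2 * M) (a * y')‖ := by
          rw [twist_mul_left a.2, ← mul_assoc]; rfl
      _ < 1 := by
          rw [split]
          refine (norm_add_le _ _).trans_lt ?_
          linarith [norm_twist_le (α := α) (v := v i) (N := 2 * M) (1 - x' * (a * y'))]
  obtain ⟨z, hz⟩ : IsUnit (X * a * Y) := by simpa using isUnit_one_sub_of_norm_lt_one norm_lt_one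
  exact ⟨↑z⁻¹ * X, Y, by rw [mul_assoc, mul_assoc, ← mul_assoc X, ← hz, Units.inv_mul]⟩

theorem HasRokhlinProperty.isPurelyInfiniteSimple_fixedPoints (hα : α.HasRokhlinProperty)
    (hA : IsPurelyInfiniteSimple A) : IsPurelyInfiniteSimple α.fixedPoints := by
  have : Nontrivial A := hA.1.1
  refine isPurelyInfiniteSimple_of_forall fun a b ha => ?_
  obtain ⟨x, y, hxy⟩ := hα.exists_mul_mul_eq_one hA ha
  exact ⟨x, y * b, by rw [← mul_assoc, hxy, one_mul]⟩

end CircleAction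

/-! ### Orthogonal isometries -/

section Isometries

variable {D : Type*} [CStarAlgebra D]

theorem isUnit_star_mul_self_of_mul_eq_one {x z : D} (h : x * z = 1) : IsUnit (star z * z) := by
  nontriviality D
  let _ := CStarAlgebra.spectralOrder D
  have := CStarAlgebra.spectralOrderedRing D
  have one_le : (1 : D) ≤ ‖star x * x‖ • (star z * z) :=
    calc (1 : D) = star z * (star x * x) * z := by
          rw [← mul_assoc, mul_assoc, h, mul_one, ← star_mul, h, star_one]
      _ ≤ ‖star x * x‖ • (star z * z) := CStarAlgebra.star_left_conjugate_le_norm_smul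
  have isUnit_smul : IsUnit (‖star x * x‖ • (star z * z)) := CStarAlgebra.isUnit_of_le 1 one_le
  have norm_ne_zero : ‖star x * x‖ ≠ 0 := fun h0 => by
    rw [h0, zero_smul] at isUnit_smul
    exact not_isUnit_zero isUnit_smul
  exact (isUnit_smul_iff (Units.mk0 _ norm_ne_zero) (star z * z)).mp isUnit_smul

theorem exists_isometry_of_mul_mul_eq_one {x e y : D} (h : x * e * y = 1) :
    ∃ t : D, star (e * t) * (e * t) = 1 := by
  refine ⟨y * cfc (fun r : ℝ => (√r)⁻¹) (star (e * y) * (e * y)), ?_⟩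
  rw [← mul_assoc e]
  exact star_polarPart_mul_self (isUnit_star_mul_self_of_mul_eq_one (by rwa [← mul_assoc]))

theorem exists_orthogonal_of_isSelfAdjoint {h : D} (hh : IsSelfAdjoint h) {x y : ℝ}
    (hx : x ∈ spectrum ℝ h) (hy : y ∈ spectrum ℝ h) (hxy : x < y) :
    ∃ e d : D, e ≠ 0 ∧ d ≠ 0 ∧ star e * d = 0 := by
  have : Nontrivial D := not_subsingleton_iff_nontrivial.mp fun _ => by
    simp [spectrum.of_subsingleton] at hx
  have cfc_ne_zero {f : ℝ → ℝ} (hf : Continuous f) {z : ℝ} (hz : z ∈ spectrum ℝ h)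
      (hfz : f z ≠ 0) : cfc f h ≠ 0 := fun h0 => by
    have mem : f z ∈ spectrum ℝ (cfc f h) := by
      rw [cfc_map_spectrum f h hh hf.continuousOn]
      exact Set.mem_image_of_mem f hz
    rw [h0, spectrum.zero_eq] at mem
    exact hfz mem
  set m := (x + y) / 2 with hm
  refine ⟨cfc (fun t : ℝ => max 0 (t - m)) h, cfc (fun t : ℝ => max 0 (m - t)) h,
    cfc_ne_zero (by fun_prop) hy ?_, cfc_ne_zero (by fun_prop) hx ?_, ?_⟩
  · exact (lt_max_of_lt_right (by linarith)).ne'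
  · exact (lt_max_of_lt_right (by linarith)).ne'
  · have star_eq := (cfc_predicate (R := ℝ) (fun t : ℝ => max 0 (t - m)) h).star_eq
    rw [star_eq, ← cfc_mul _ _ h (by fun_prop) (by fun_prop), ← cfc_zero ℝ h]
    refine cfc_congr fun t _ => ?_
    rcases le_total t m with htm | htm
    · simp [htm]
    · simp [htm]

theorem exists_eq_algebraMap_of_spectrum_subsingleton [Nontrivial D] {h : D}
    (hh : IsSelfAdjoint h) (hs : (spectrum ℝ h).Subsingleton) : ∃ c : ℂ, h = algebraMap ℂ D c := by
  obtain ⟨x, hx⟩ := ContinuousFunctionalCalculus.spectrum_nonempty (R := ℝ) h hh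
  refine ⟨x, ?_⟩
  calc h = cfc (fun y : ℝ => y) h := (cfc_id' ℝ h).symm
    _ = cfc (fun _ : ℝ => x) h := cfc_congr fun y hy => hs hy hx
    _ = algebraMap ℂ D x := by
      rw [cfc_const x h, Algebra.algebraMap_eq_smul_one, Algebra.algebraMap_eq_smul_one,
        Complex.coe_smul]

theorem exists_orthogonal_or_forall_eq_algebraMap (D : Type*) [CStarAlgebra D] [Nontrivial D] :
    (∃ e d : D, e ≠ 0 ∧ d ≠ 0 ∧ star e * d = 0) ∨ ∀ a : D, ∃ c : ℂ, a = algebraMap ℂ D c := by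
  by_cases H : ∀ h : D, IsSelfAdjoint h → (spectrum ℝ h).Subsingleton
  · refine Or.inr fun a => ?_
    obtain ⟨c, hc⟩ :=
      exists_eq_algebraMap_of_spectrum_subsingleton (realPart a).2 (H _ (realPart a).2)
    obtain ⟨d, hd⟩ :=
      exists_eq_algebraMap_of_spectrum_subsingleton (imaginaryPart a).2 (H _ (imaginaryPart a).2)
    refine ⟨c + Complex.I * d, ?_⟩
    rw [map_add, map_mul, ← hc, ← hd, ← Algebra.smul_def, realPart_add_I_smul_imaginaryPart]
  · push Not at H
    obtain ⟨h, hh, hs⟩ := H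
    obtain ⟨x, hx, y, hy, hxy⟩ := hs.exists_lt
    exact Or.inl (exists_orthogonal_of_isSelfAdjoint hh hx hy hxy)

theorem exists_orthogonal_isometries_of_pair {a b : D} (ha : star a * a = 1) (hb : star b * b = 1)
    (hab : star a * b = 0) :
    ∃ s : ℕ → D, ∀ k l, star (s k) * s l = if k = l then 1 else 0 := by
  have hba : star b * a = 0 := by simpa using congrArg star hab
  have star_pow_mul_pow (k : ℕ) : star (a ^ k) * a ^ k = 1 := by
    induction k with
    | zero => simp
    | succ k ih => rw [pow_succ', star_mul, mul_assoc, ← mul_assoc (star a), ha, one_mul, ih]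
  have orthogonal (k m : ℕ) : star (a ^ k * b) * (a ^ (k + m + 1) * b) = 0 := by
    rw [add_assoc, pow_add, star_mul, mul_assoc, mul_assoc (a ^ k), ← mul_assoc (star (a ^ k)),
      star_pow_mul_pow, one_mul, pow_succ', mul_assoc, ← mul_assoc, hba, zero_mul]
  refine ⟨fun k => a ^ k * b, fun k l => ?_⟩
  rcases lt_trichotomy k l with h | rfl | h
  · obtain ⟨m, rfl⟩ := Nat.exists_eq_add_of_lt h
    rw [if_neg h.ne, orthogonal]
  · rw [if_pos rfl, star_mul, mul_assoc, ← mul_assoc (star (a ^ k)), star_pow_mul_pow, one_mul, hb]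
  · obtain ⟨m, rfl⟩ := Nat.exists_eq_add_of_lt h
    rw [if_neg h.ne', ← star_eq_zero, star_mul, star_star, orthogonal]

namespace IsPurelyInfiniteSimple

theorem exists_orthogonal_isometries (hD : IsPurelyInfiniteSimple D)
    (h : ¬ ∀ a : D, ∃ c : ℂ, a = algebraMap ℂ D c) :
    ∃ s : ℕ → D, ∀ k l, star (s k) * s l = if k = l then 1 else 0 := by
  have : Nontrivial D := hD.1.1
  obtain ⟨e, d, he, hd, hed⟩ := (exists_orthogonal_or_forall_eq_algebraMap D).resolve_right h
  obtain ⟨x, y, hxy⟩ := hD.2 e 1 he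
  obtain ⟨t, ht⟩ := exists_isometry_of_mul_mul_eq_one hxy
  obtain ⟨x', y', hxy'⟩ := hD.2 d 1 hd
  obtain ⟨t', ht'⟩ := exists_isometry_of_mul_mul_eq_one hxy'
  refine exists_orthogonal_isometries_of_pair ht ht' ?_
  rw [star_mul, mul_assoc, ← mul_assoc (star e), hed, zero_mul, mul_zero]

theorem exists_eq_algebraMap_of_forall_commute (hD : IsPurelyInfiniteSimple D) {z : D}
    (hz : ∀ a, Commute a z) : ∃ c : ℂ, z = algebraMap ℂ D c := by
  have : Nontrivial D := hD.1.1
  obtain ⟨c, hc⟩ := spectrum.nonempty z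
  refine ⟨c, (sub_eq_zero.mp <| of_not_not fun h => hc ?_).symm⟩
  obtain ⟨x, y, hxy⟩ := hD.2 (algebraMap ℂ D c - z) 1 h
  have commute (a : D) : Commute a (algebraMap ℂ D c - z) :=
    (Algebra.commute_algebraMap_right c a).sub_right (hz a)
  refine isUnit_iff_exists_and_exists.mpr ⟨⟨x * y, ?_⟩, x * y, ?_⟩
  · rw [← mul_assoc, ← (commute x).eq, hxy]
  · rw [mul_assoc, (commute y).eq, ← mul_assoc, hxy]

end IsPurelyInfiniteSimple

end Isometries

namespace CircleAction

variable {A : Type u} [CStarAlgebra A] {α : CircleAction A}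

theorem mul_zpow_neg_mem_fixedPoints {v : unitary A} (hv : v ∈ α.eigenunitaries) {n : ℤ} {a : A}
    (ha : a ∈ α.spectralSubspace n) : a * ((v ^ (-n) : unitary A) : A) ∈ α.fixedPoints :=
  mem_spectralSubspace_zero.mp <| by
    simpa only [add_neg_cancel] using
      mul_mem_spectralSubspace ha (zpow_mem_spectralSubspace hv (-n))

theorem commute_eigenunitary_of_fixedPoints_scalar {v : unitary A} (hv : v ∈ α.eigenunitaries)
    (h : ∀ a : α.fixedPoints, ∃ c : ℂ, a = algebraMap ℂ α.fixedPoints c) (a : A) :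
    Commute a v := by
  have commute_of_mem {n : ℤ} {a : A} (ha : a ∈ α.spectralSubspace n) : Commute a v := by
    obtain ⟨c, hc⟩ := h ⟨_, mul_zpow_neg_mem_fixedPoints hv ha⟩
    have a_eq : a = algebraMap ℂ A c * ((v ^ n : unitary A) : A) := by
      have mul_zpow_neg : a * ((v ^ (-n) : unitary A) : A) = algebraMap ℂ A c :=
        congrArg Subtype.val hc
      rw [← mul_zpow_neg, mul_assoc, ← Submonoid.coe_mul, zpow_neg, inv_mul_cancel]
      simp
    rw [a_eq]
    exact (Algebra.commute_algebraMap_left c _).mul_left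
      (congrArg Subtype.val (Commute.zpow_self v n).eq)
  have isClosed : IsClosed {a : A | Commute a v} :=
    isClosed_eq (continuous_id.mul continuous_const) (continuous_const.mul continuous_id)
  refine closure_minimal (fun b hb => ?_) isClosed
    (α.toIsometricCircleRep.dense_iSup_weightSpace a)
  induction hb using Submodule.iSup_induction' with
  | mem n a ha => exact commute_of_mem ha
  | zero => exact Commute.zero_left _
  | add a b _ _ iha ihb => exact iha.add_left ihb

theorem HasRokhlinProperty.not_forall_eq_algebraMap (hα : α.HasRokhlinProperty)
    (hA : IsPurelyInfiniteSimple A) :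
    ¬ ∀ a : α.fixedPoints, ∃ c : ℂ, a = algebraMap ℂ α.fixedPoints c := by
  intro h
  have : Nontrivial A := hA.1.1
  obtain ⟨w, hw, -⟩ := hα.exists_asymptoticallyCentral
  obtain ⟨c, hc⟩ := hA.exists_eq_algebraMap_of_forall_commute
    (commute_eigenunitary_of_fixedPoints_scalar (hw (∅, 0)) h)
  have mem_zero : (w (∅, 0) : A) ∈ α.spectralSubspace 0 :=
    mem_spectralSubspace_zero.mpr (hc ▸ algebraMap_mem α.fixedPoints c)
  have eq_zero : (w (∅, 0) : A) = 0 := by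
    have h0 := IsometricCircleRep.weightProj_apply_of_mem _ mem_zero 0
    rwa [IsometricCircleRep.weightProj_apply_of_mem _ (hw (∅, 0)), if_neg one_ne_zero,
      if_pos rfl, eq_comm] at h0
  exact one_ne_zero ((CStarRing.norm_coe_unitary (w (∅, 0))).symm.trans (eq_zero ▸ norm_zero))

end CircleAction

/-! ### Matrix units -/

section MatrixUnits

open Filter Topology

theorem exists_hasSum_norm_le_geometric {E : Type*} [NormedAddCommGroup E] [CompleteSpace E]
    {S : AddSubgroup E} (hS : Dense (S : Set E)) (c : E) {r : ℝ} (hr0 : 0 < r) (hr1 : r < 1) :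
    ∃ d : ℕ → E, HasSum d c ∧ (∀ k, d k ∈ S) ∧ ∀ k, ‖d k‖ ≤ (‖c‖ + 1) * r ^ k := by
  obtain ⟨d, tendsto_sum, d_mem, d_zero, d_succ⟩ :=
    controlled_sum_of_mem_closure (hS c) (b := fun k => r ^ k) fun k => pow_pos hr0 k
  have norm_d_le (k : ℕ) : ‖d k‖ ≤ (‖c‖ + 1) * r ^ k := by
    rcases Nat.eq_zero_or_pos k with rfl | hk
    · have d_zero' : ‖c - d 0‖ < 1 := by simpa [neg_add_eq_sub] using d_zero
      rw [pow_zero]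
      linarith [norm_le_norm_add_norm_sub c (d 0)]
    · exact (d_succ k hk).le.trans
        (le_mul_of_one_le_left (pow_pos hr0 k).le (by linarith [norm_nonneg c]))
  have summable_d : Summable d := Summable.of_norm_bounded
    ((summable_geometric_of_lt_one hr0.le hr1).mul_left _) norm_d_le
  refine ⟨d, ?_, d_mem, norm_d_le⟩
  rw [← tendsto_nhds_unique
    (summable_d.hasSum.tendsto_sum_nat.comp (tendsto_add_atTop_nat 1)) tendsto_sum]
  exact summable_d.hasSum

theorem exists_mul_eq_of_orthogonal {B : Type*} [NonUnitalCStarAlgebra B] {p c : B}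
    {d q V : ℕ → B} {C : ℝ} (hd : HasSum d c) (norm_d_le : ∀ k, ‖d k‖ ≤ C * (1 / 4) ^ k)
    (norm_V_le : ∀ k, ‖V k‖ ≤ 1) (star_V_mul_V : ∀ k l, star (V k) * V l = if k = l then q k else 0)
    (d_mul_q : ∀ k, d k * q k = d k) (p_mul_V : ∀ k, p * V k = V k) :
    ∃ x y : B, x * p * y = c := by
  have norm_two_pow (k : ℕ) : ‖(2 : ℂ) ^ k‖ = 2 ^ k := by simp
  have summable_left : Summable fun k => (2 : ℂ) ^ k • (d k * star (V k)) := by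
    refine Summable.of_norm_bounded (g := fun k : ℕ => C * (1 / 2) ^ k)
      (summable_geometric_two.mul_left _) fun k => ?_
    calc ‖(2 : ℂ) ^ k • (d k * star (V k))‖ ≤ 2 ^ k * (C * (1 / 4) ^ k * 1) := by
          rw [norm_smul, norm_two_pow]
          gcongr
          exact norm_mul_le_of_le (norm_d_le k) ((norm_star _).trans_le (norm_V_le k))
      _ = C * (2 * (1 / 4)) ^ k := by rw [mul_pow]; ring
      _ = C * (1 / 2) ^ k := by norm_num
  have summable_right : Summable fun k => ((2 : ℂ) ^ k)⁻¹ • V k := by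
    refine Summable.of_norm_bounded (g := fun k : ℕ => (1 / 2 : ℝ) ^ k)
      summable_geometric_two fun k => ?_
    rw [norm_smul, norm_inv, norm_two_pow, one_div, inv_pow]
    exact mul_le_of_le_one_right (by positivity) (norm_V_le k)
  set y := ∑' k, ((2 : ℂ) ^ k)⁻¹ • V k with hy
  have p_mul_y : p * y = y := by
    rw [hy, ← summable_right.tsum_mul_left]
    simp only [mul_smul_comm, p_mul_V]
  have star_V_mul_y (k : ℕ) : star (V k) * y = ((2 : ℂ) ^ k)⁻¹ • q k := by
    rw [hy, ← summable_right.tsum_mul_left, tsum_eq_single k fun l hl => ?_]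
    · rw [mul_smul_comm, star_V_mul_V, if_pos rfl]
    · rw [mul_smul_comm, star_V_mul_V, if_neg hl.symm, smul_zero]
  refine ⟨∑' k, (2 : ℂ) ^ k • (d k * star (V k)), y, ?_⟩
  rw [mul_assoc, p_mul_y, ← summable_left.tsum_mul_right, ← hd.tsum_eq]
  refine tsum_congr fun k => ?_
  rw [smul_mul_assoc, mul_assoc, star_V_mul_y, mul_smul_comm, d_mul_q, smul_smul,
    mul_inv_cancel₀ (pow_ne_zero _ two_ne_zero), one_smul]

/-- Matrix units in `B` with coefficients in `D`: `entry i j a` plays the role of the matrix whose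
only nonzero coefficient is `a`, in position `(i, j)`. The index set may be infinite. -/
structure MatrixUnits (I : Type*) [DecidableEq I] (D : Type*) [CStarAlgebra D] (B : Type*)
    [NonUnitalCStarAlgebra B] where
  entry : I → I → D →ₗ[ℂ] B
  entry_mul_entry : ∀ i j k l a b,
    entry i j a * entry k l b = if j = k then entry i l (a * b) else 0
  star_entry : ∀ i j a, star (entry i j a) = entry j i (star a)

namespace MatrixUnits

variable {I : Type*} [DecidableEq I] {D : Type*} [CStarAlgebra D] {B : Type*}
  [NonUnitalCStarAlgebra B] (E : MatrixUnits I D B)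

theorem entry_mul_entry_same (i j k : I) (a b : D) :
    E.entry i j a * E.entry j k b = E.entry i k (a * b) := by
  rw [E.entry_mul_entry, if_pos rfl]

theorem entry_mul_entry_of_ne {i j k l : I} (h : j ≠ k) (a b : D) :
    E.entry i j a * E.entry k l b = 0 := by
  rw [E.entry_mul_entry, if_neg h]

/-- The ⋆-algebra of matrices with finitely many nonzero coefficients. -/
def entrySpan : NonUnitalStarSubalgebra ℂ B where
  __ := Submodule.span ℂ {b | ∃ i j a, E.entry i j a = b}
  mul_mem' {x y} hx hy := by
    refine LinearMap.BilinMap.apply_apply_mem_of_mem_span _ _ _ (LinearMap.mul ℂ B) ?_ x y hx hy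
    rintro _ ⟨i, j, a, rfl⟩ _ ⟨k, l, b, rfl⟩
    rw [LinearMap.mul_apply', E.entry_mul_entry]
    split_ifs
    · exact Submodule.subset_span ⟨i, l, a * b, rfl⟩
    · exact zero_mem _
  star_mem' {x} hx := by
    induction hx using Submodule.span_induction with
    | mem x hx =>
      obtain ⟨i, j, a, rfl⟩ := hx
      exact Submodule.subset_span ⟨j, i, star a, (E.star_entry i j a).symm⟩
    | zero => simp
    | add x y _ _ hx hy => simpa using add_mem hx hy
    | smul c x _ hx => simpa using Submodule.smul_mem _ (star c) hx

theorem entry_mem_entrySpan (i j : I) (a : D) : E.entry i j a ∈ E.entrySpan :=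
  Submodule.subset_span ⟨i, j, a, rfl⟩

variable {E} in
@[elab_as_elim]
theorem entrySpan_induction {p : (z : B) → z ∈ E.entrySpan → Prop}
    (entry : ∀ i j a, p (E.entry i j a) (E.entry_mem_entrySpan i j a)) (zero : p 0 (zero_mem _))
    (add : ∀ x y hx hy, p x hx → p y hy → p (x + y) (add_mem hx hy))
    (smul : ∀ (c : ℂ) x hx, p x hx → p (c • x) (SMulMemClass.smul_mem c hx)) {z : B}
    (hz : z ∈ E.entrySpan) : p z hz := by
  refine Submodule.span_induction (p := fun z hz => p z hz) ?_ zero add smul hz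
  rintro _ ⟨i, j, a, rfl⟩
  exact entry i j a

/-- The projection onto finitely many coordinates. -/
noncomputable def coordProj (F : Finset I) : B := ∑ i ∈ F, E.entry i i 1

theorem coordProj_mul_entry {F : Finset I} {i : I} (hi : i ∈ F) (j : I) (a : D) :
    E.coordProj F * E.entry i j a = E.entry i j a := by
  rw [coordProj, Finset.sum_mul, Finset.sum_eq_single_of_mem i hi fun k _ hk =>
    E.entry_mul_entry_of_ne hk _ _, entry_mul_entry_same, one_mul]

theorem entry_mul_coordProj {F : Finset I} {j : I} (hj : j ∈ F) (i : I) (a : D) :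
    E.entry i j a * E.coordProj F = E.entry i j a := by
  rw [coordProj, Finset.mul_sum, Finset.sum_eq_single_of_mem j hj fun k _ hk =>
    E.entry_mul_entry_of_ne hk.symm _ _, entry_mul_entry_same, mul_one]

theorem isStarProjection_coordProj (F : Finset I) : IsStarProjection (E.coordProj F) where
  isIdempotentElem := by
    rw [IsIdempotentElem]
    nth_rw 2 3 [coordProj]
    rw [Finset.mul_sum]
    exact Finset.sum_congr rfl fun i hi => E.coordProj_mul_entry hi i 1
  isSelfAdjoint := by simp [IsSelfAdjoint, coordProj, star_sum, E.star_entry]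

theorem eventually_coordProj_mul_eq {z : B} (hz : z ∈ E.entrySpan) :
    ∀ᶠ F in atTop, E.coordProj F * z = z ∧ z * E.coordProj F = z := by
  induction hz using entrySpan_induction with
  | entry i j a =>
    filter_upwards [eventually_ge_atTop {i, j}] with F hF
    exact ⟨E.coordProj_mul_entry (hF (by simp)) j a, E.entry_mul_coordProj (hF (by simp)) i a⟩
  | zero => simp
  | add z w _ _ hz hw =>
    filter_upwards [hz, hw] with F hzF hwF
    rw [mul_add, add_mul, hzF.1, hzF.2, hwF.1, hwF.2]
    exact ⟨rfl, rfl⟩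
  | smul c z _ hz =>
    filter_upwards [hz] with F hzF
    rw [mul_smul_comm, smul_mul_assoc, hzF.1, hzF.2]
    exact ⟨rfl, rfl⟩

variable {E} in
theorem exists_coordProj_mul_mul_coordProj_ne_zero (hE : Dense (E.entrySpan : Set B)) {b : B}
    (hb : b ≠ 0) : ∃ F, E.coordProj F * b * E.coordProj F ≠ 0 := by
  by_contra! H
  obtain ⟨z, hz, z_near⟩ := Metric.mem_closure_iff.mp (hE b) (‖b‖ / 2) (by positivity)
  rw [dist_eq_norm] at z_near
  obtain ⟨F, mul_z, z_mul⟩ := (E.eventually_coordProj_mul_eq hz).exists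
  have norm_z_le : ‖z‖ ≤ ‖b - z‖ := by
    have norm_coordProj_le := IsStarProjection.norm_le _ (E.isStarProjection_coordProj F)
    calc ‖z‖ = ‖E.coordProj F * (b - z) * E.coordProj F‖ := by
          rw [mul_sub, sub_mul, H, mul_z, z_mul, zero_sub, norm_neg]
      _ ≤ 1 * ‖b - z‖ * 1 :=
          norm_mul_le_of_le (norm_mul_le_of_le norm_coordProj_le le_rfl) norm_coordProj_le
      _ = ‖b - z‖ := by ring
  linarith [norm_le_norm_add_norm_sub' b z]

variable {E} in
theorem exists_entry_mul_mul_entry_ne_zero (hE : Dense (E.entrySpan : Set B)) (o : I) {b : B}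
    (hb : b ≠ 0) : ∃ i j, E.entry o i 1 * b * E.entry j o 1 ≠ 0 := by
  obtain ⟨F, hF⟩ := exists_coordProj_mul_mul_coordProj_ne_zero hE hb
  contrapose! hF
  simp only [coordProj, Finset.sum_mul, Finset.mul_sum]
  refine Finset.sum_eq_zero fun j _ => Finset.sum_eq_zero fun i _ => ?_
  calc E.entry i i 1 * b * E.entry j j 1
      = (E.entry i o 1 * E.entry o i 1) * b * (E.entry j o 1 * E.entry o j 1) := by
        rw [entry_mul_entry_same, entry_mul_entry_same, one_mul]
    _ = E.entry i o 1 * (E.entry o i 1 * b * E.entry j o 1) * E.entry o j 1 := by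
        simp only [mul_assoc]
    _ = 0 := by rw [hF, mul_zero, zero_mul]

/-- The embedding of `D` as a diagonal corner. -/
noncomputable def corner (o : I) : D →⋆ₙₐ[ℂ] B where
  toFun := E.entry o o
  map_smul' := map_smul _
  map_zero' := map_zero _
  map_add' := map_add _
  map_mul' a b := (E.entry_mul_entry_same o o o a b).symm
  map_star' a := (E.star_entry o o a).symm

theorem corner_apply (o : I) (a : D) : E.corner o a = E.entry o o a :=
  rfl

variable {E}

theorem corner_injective (hD : IsPurelyInfiniteSimple D) {o : I} (ho : E.entry o o 1 ≠ 0) :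
    Function.Injective (E.corner o) := by
  rw [injective_iff_map_eq_zero]
  intro a ha
  by_contra a_ne_zero
  obtain ⟨x, y, hxy⟩ := hD.2 a 1 a_ne_zero
  rw [← corner_apply, ← hxy, map_mul, map_mul, ha, mul_zero, zero_mul] at ho
  exact ho rfl

theorem entry_mul_mul_entry_mem_range_corner (hE : Dense (E.entrySpan : Set B))
    (hD : IsPurelyInfiniteSimple D) {o : I} (ho : E.entry o o 1 ≠ 0) (i j : I) (b : B) :
    E.entry o i 1 * b * E.entry j o 1 ∈ Set.range (E.corner o) := by
  have isometry_corner : Isometry (E.corner o) := AddMonoidHomClass.isometry_of_norm _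
    (NonUnitalStarAlgHom.norm_map _ (corner_injective hD ho))
  have isClosed_preimage :
      IsClosed {b | E.entry o i 1 * b * E.entry j o 1 ∈ Set.range (E.corner o)} :=
    isometry_corner.isClosedEmbedding.isClosed_range.preimage (by fun_prop)
  refine closure_minimal (fun z hz => ?_) isClosed_preimage (hE b)
  induction hz using entrySpan_induction with
  | entry k l a =>
    rw [Set.mem_ofPred_eq, E.entry_mul_entry, ite_mul, E.entry_mul_entry, zero_mul]
    split_ifs
    · exact ⟨1 * a * 1, rfl⟩
    · exact ⟨0, map_zero _⟩
    · exact ⟨0, map_zero _⟩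
  | zero => exact ⟨0, by simp⟩
  | add z w _ _ hz hw =>
    obtain ⟨a, ha⟩ := hz
    obtain ⟨b, hb⟩ := hw
    exact ⟨a + b, by rw [map_add, ha, hb, mul_add, add_mul]⟩
  | smul c z _ hz =>
    obtain ⟨a, ha⟩ := hz
    exact ⟨c • a, by rw [map_smul, ha, mul_smul_comm, smul_mul_assoc]⟩

theorem exists_mul_mul_eq_entry (hE : Dense (E.entrySpan : Set B))
    (hD : IsPurelyInfiniteSimple D) {o : I} (ho : E.entry o o 1 ≠ 0) {b : B} (hb : b ≠ 0) :
    ∃ x y : B, x * b * y = E.entry o o 1 := by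
  obtain ⟨i, j, hij⟩ := exists_entry_mul_mul_entry_ne_zero hE o hb
  obtain ⟨a, ha⟩ := entry_mul_mul_entry_mem_range_corner hE hD ho i j b
  have a_ne_zero : a ≠ 0 := by
    rintro rfl
    exact hij (by rw [← ha, map_zero])
  obtain ⟨x, y, hxy⟩ := hD.2 a 1 a_ne_zero
  refine ⟨E.corner o x * E.entry o i 1, E.entry j o 1 * E.corner o y, ?_⟩
  calc E.corner o x * E.entry o i 1 * b * (E.entry j o 1 * E.corner o y)
      = E.corner o x * (E.entry o i 1 * b * E.entry j o 1) * E.corner o y := by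
        simp only [mul_assoc]
    _ = E.entry o o 1 := by rw [← ha, ← map_mul, ← map_mul, hxy, corner_apply]

theorem exists_mul_entry_mul_eq (hE : Dense (E.entrySpan : Set B)) {s : ℕ × I → D}
    (hs : ∀ p q, star (s p) * s q = if p = q then 1 else 0) (o : I) (c : B) :
    ∃ x y : B, x * E.entry o o 1 * y = c := by
  obtain ⟨d, hasSum_d, d_mem, norm_d_le⟩ := exists_hasSum_norm_le_geometric
    (S := E.entrySpan.toAddSubgroup) hE c (r := 1 / 4) (by norm_num) (by norm_num)
  choose F hF using fun k => (E.eventually_coordProj_mul_eq (d_mem k)).exists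
  let V (k : ℕ) : B := ∑ i ∈ F k, E.entry o i (s (k, i))
  have star_V_mul_V (k l : ℕ) :
      star (V k) * V l = if k = l then E.coordProj (F k) else 0 := by
    simp only [V, star_sum, E.star_entry, Finset.sum_mul, Finset.mul_sum, entry_mul_entry_same, hs,
      Prod.mk.injEq]
    split_ifs with h
    · subst h
      refine Finset.sum_congr rfl fun i hi => ?_
      rw [Finset.sum_eq_single_of_mem i hi fun j _ hj => by simp [hj]]
      simp
    · simp [h]
  have norm_V_le (k : ℕ) : ‖V k‖ ≤ 1 := by
    rw [← abs_of_nonneg (norm_nonneg (V k)), abs_le_one_iff_mul_self_le_one,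
      ← CStarRing.norm_star_mul_self, star_V_mul_V, if_pos rfl]
    exact IsStarProjection.norm_le _ (E.isStarProjection_coordProj _)
  refine exists_mul_eq_of_orthogonal hasSum_d norm_d_le norm_V_le star_V_mul_V
    (fun k => (hF k).2) fun k => ?_
  simp only [V, Finset.mul_sum, entry_mul_entry_same, one_mul]

theorem isPurelyInfiniteSimple (hE : Dense (E.entrySpan : Set B)) (hD : IsPurelyInfiniteSimple D)
    {o : I} (ho : E.entry o o 1 ≠ 0) {s : ℕ × I → D}
    (hs : ∀ p q, star (s p) * s q = if p = q then 1 else 0) : IsPurelyInfiniteSimple B := by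
  have : Nontrivial B := ⟨_, _, ho⟩
  refine isPurelyInfiniteSimple_of_forall fun b c hb => ?_
  obtain ⟨x, y, hxy⟩ := exists_mul_mul_eq_entry hE hD ho hb
  obtain ⟨x', y', rfl⟩ := exists_mul_entry_mul_eq hE hs o c
  refine ⟨x' * x, y * y', ?_⟩
  rw [← hxy]
  simp only [mul_assoc]

end MatrixUnits

end MatrixUnits

/-! ### Covariant representations -/

section Monomial

open CircleAction

/-- Rotation of the functions on the circle: `(T_ζ f)(η) = f (ζ η)`. -/
noncomputable def translation (E : Type*) [NormedAddCommGroup E] [NormedSpace ℂ E] :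
    IsometricCircleRep C(Circle, E) where
  toHom :=
    { toFun := fun ζ => LinearIsometryEquiv.ofSurjective
        { toFun := fun f => f.comp ⟨(ζ * ·), by fun_prop⟩
          map_add' := fun f g => rfl
          map_smul' := fun c f => rfl
          norm_map' := fun f => by
            simp only [ContinuousMap.norm_eq_iSup_norm]
            exact (Equiv.mulLeft ζ).surjective.iSup_comp fun η => ‖f η‖ }
        fun f => ⟨f.comp ⟨(ζ⁻¹ * ·), by fun_prop⟩, ContinuousMap.ext fun η => by simp⟩
      map_one' := by ext f η; simp
      map_mul' := fun ζ ζ' => by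
        ext f η
        change f (ζ * ζ' * η) = f (ζ' * (ζ * η))
        rw [mul_comm ζ, mul_assoc] }
  continuous_apply f :=
    (ContinuousMap.curry ⟨fun p : Circle × Circle => f (p.1 * p.2), by fun_prop⟩).continuous

theorem translation_apply {E : Type*} [NormedAddCommGroup E] [NormedSpace ℂ E] (f : C(Circle, E))
    (ζ η : Circle) : translation E ζ f η = f (ζ * η) :=
  rfl

/-- The function `ζ ↦ ζⁿ x` on the circle. -/
noncomputable def monomial {E : Type*} [NormedAddCommGroup E] [NormedSpace ℂ E] (n : ℤ) :
    E →L[ℂ] C(Circle, E) :=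
  LinearMap.mkContinuous
    { toFun := fun x => ⟨fun ζ => (ζ : ℂ) ^ n • x, by fun_prop⟩
      map_add' := fun x y => by ext ζ; simp
      map_smul' := fun c x => by ext ζ; exact smul_comm _ _ _ }
    1 fun x => (ContinuousMap.norm_le _ (by positivity)).mpr fun ζ => by
      change ‖(ζ : ℂ) ^ n • x‖ ≤ 1 * ‖x‖
      rw [norm_smul, norm_coe_zpow]

theorem monomial_apply {E : Type*} [NormedAddCommGroup E] [NormedSpace ℂ E] (n : ℤ) (x : E)
    (ζ : Circle) : monomial n x ζ = (ζ : ℂ) ^ n • x :=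
  rfl

theorem eq_monomial_of_mem_weightSpace {E : Type*} [NormedAddCommGroup E] [NormedSpace ℂ E]
    {n : ℤ} {f : C(Circle, E)} (hf : f ∈ (translation E).weightSpace n) :
    f = monomial n (f 1) := by
  ext ζ
  simpa [translation_apply, monomial_apply] using DFunLike.congr_fun (hf ζ) 1

theorem map_mem_closure_of_forall_monomial_mem {A M : Type*} [CStarAlgebra A] (α : CircleAction A)
    [NormedAddCommGroup M] [NormedSpace ℂ M] (R : C(Circle, A) →L[ℂ] M) {K : Submodule ℂ M}
    (h : ∀ n k, ∀ a ∈ α.spectralSubspace k, R (monomial n a) ∈ K) (f : C(Circle, A)) :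
    R f ∈ closure (K : Set M) := by
  let L : Submodule ℂ C(Circle, A) := K.topologicalClosure.comap R.toLinearMap
  have isClosed_L : IsClosed (L : Set C(Circle, A)) :=
    K.isClosed_topologicalClosure.preimage R.continuous
  have monomial_mem (n : ℤ) (a : A) : monomial n a ∈ L := by
    have iSup_le_comap : ⨆ k, α.spectralSubspace k ≤ L.comap (monomial n).toLinearMap :=
      iSup_le fun k a ha => K.le_topologicalClosure (h n k a ha)
    exact closure_minimal iSup_le_comap (isClosed_L.preimage (monomial n).continuous)
      (α.toIsometricCircleRep.dense_iSup_weightSpace a)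
  have iSup_weightSpace_le : ⨆ n, (translation A).weightSpace n ≤ L :=
    iSup_le fun n f hf => eq_monomial_of_mem_weightSpace hf ▸ monomial_mem n _
  exact closure_minimal iSup_weightSpace_le isClosed_L ((translation A).dense_iSup_weightSpace f)

end Monomial

namespace CircleAction

variable {A : Type u} [CStarAlgebra A] {α : CircleAction A}

namespace CovariantRep

variable (ρ : CovariantRep α)

/-- The unitary representation `U` of `ρ = (π, U)` as an isometric representation. -/
noncomputable def toIsometricCircleRep : IsometricCircleRep ρ.H where
  toHom := (Unitary.linearIsometryEquiv (𝕜 := ℂ) (H := ρ.H)).toMonoidHom.comp ρ.U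
  continuous_apply := ρ.continuous_U

/-- The projection of `ρ.H` onto the isotypic component of `U` at the character `ζ ↦ ζⁿ`. -/
noncomputable abbrev isotypicProj (n : ℤ) : ρ.H →L[ℂ] ρ.H :=
  ρ.toIsometricCircleRep.weightProj n

theorem isotypicProj_apply (n : ℤ) (ξ : ρ.H) : ρ.isotypicProj n ξ =
    ∫ ζ : Circle, (ζ : ℂ) ^ (-n) • (ρ.U ζ : ρ.H →L[ℂ] ρ.H) ξ ∂haarCircle :=
  rfl

theorem isotypicProj_mul_isotypicProj (m n : ℤ) :
    ρ.isotypicProj m * ρ.isotypicProj n = if m = n then ρ.isotypicProj n else 0 := by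
  ext ξ
  rw [mul_apply_eq_comp, ρ.toIsometricCircleRep.weightProj_apply_of_mem
    (ρ.toIsometricCircleRep.weightProj_mem n ξ)]
  simp only [eq_comm (a := m)]
  split_ifs <;> rfl

theorem integrable_zpow_smul_U (n : ℤ) (ξ : ρ.H) :
    Integrable (fun ζ : Circle => (ζ : ℂ) ^ n • (ρ.U ζ : ρ.H →L[ℂ] ρ.H) ξ) haarCircle :=
  integrable_of_continuous (ρ.toIsometricCircleRep.continuous_zpow_smul_apply n ξ)

theorem star_isotypicProj (n : ℤ) : star (ρ.isotypicProj n) = ρ.isotypicProj n := by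
  have inner_U (ζ : Circle) (ξ η : ρ.H) :
      inner ℂ ((ρ.U ζ : ρ.H →L[ℂ] ρ.H) ξ) η = inner ℂ ξ ((ρ.U ζ⁻¹ : ρ.H →L[ℂ] ρ.H) η) := by
    rw [map_inv, ← Unitary.star_eq_inv, Unitary.coe_star, ContinuousLinearMap.star_eq_adjoint,
      ContinuousLinearMap.adjoint_inner_right]
  rw [ContinuousLinearMap.star_eq_adjoint, eq_comm, ContinuousLinearMap.eq_adjoint_iff]
  intro ξ η
  rw [isotypicProj_apply, isotypicProj_apply, ← integral_inner (ρ.integrable_zpow_smul_U _ η),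
    ← inner_conj_symm, ← integral_inner (ρ.integrable_zpow_smul_U _ ξ), ← integral_conj,
    ← integral_inv_eq_self _ haarCircle]
  refine integral_congr_ae (.of_forall fun ζ => ?_)
  beta_reduce
  rw [inner_conj_symm, inner_smul_left, inner_smul_right, inner_U, inv_inv, map_zpow₀,
    ← Circle.coe_inv_eq_conj, inv_inv]

theorem isotypicProj_mul_π (n : ℤ) {k : ℤ} {a : A} (ha : a ∈ α.spectralSubspace k) :
    ρ.isotypicProj n * ρ.π a = ρ.π a * ρ.isotypicProj (n - k) := by
  have U_mul_π (ζ : Circle) : (ρ.U ζ : ρ.H →L[ℂ] ρ.H) * ρ.π a =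
      (ζ : ℂ) ^ k • (ρ.π a * (ρ.U ζ : ρ.H →L[ℂ] ρ.H)) := by
    rw [← smul_mul_assoc, ← map_smul, ← mem_spectralSubspace.mp ha, ← ρ.covariant, mul_assoc,
      Unitary.coe_star_mul_self, mul_one]
  ext ξ
  calc ρ.isotypicProj n (ρ.π a ξ)
      = ∫ ζ : Circle, ρ.π a ((ζ : ℂ) ^ (-(n - k)) • (ρ.U ζ : ρ.H →L[ℂ] ρ.H) ξ) ∂haarCircle := by
        refine integral_congr_ae (.of_forall fun ζ => ?_)
        have U_π_apply : (ρ.U ζ : ρ.H →L[ℂ] ρ.H) (ρ.π a ξ) =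
            (ζ : ℂ) ^ k • ρ.π a ((ρ.U ζ : ρ.H →L[ℂ] ρ.H) ξ) := DFunLike.congr_fun (U_mul_π ζ) ξ
        calc (ζ : ℂ) ^ (-n) • (ρ.U ζ : ρ.H →L[ℂ] ρ.H) (ρ.π a ξ)
            = (ζ : ℂ) ^ (-(n - k)) • ρ.π a ((ρ.U ζ : ρ.H →L[ℂ] ρ.H) ξ) := by
              rw [U_π_apply, smul_smul, ← zpow_add₀ ζ.coe_ne_zero, neg_sub, neg_add_eq_sub]
          _ = _ := (map_smul _ _ _).symm
    _ = ρ.π a (ρ.isotypicProj (n - k) ξ) :=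
        (ρ.π a).integral_comp_comm (ρ.integrable_zpow_smul_U _ ξ)

theorem integrated_monomial (n : ℤ) (a : A) :
    ρ.integrated (monomial (-n) a) = ρ.π a * ρ.isotypicProj n := by
  ext ξ
  calc ∫ ζ : Circle, ρ.π ((ζ : ℂ) ^ (-n) • a) ((ρ.U ζ : ρ.H →L[ℂ] ρ.H) ξ) ∂haarCircle
      = ∫ ζ : Circle, ρ.π a ((ζ : ℂ) ^ (-n) • (ρ.U ζ : ρ.H →L[ℂ] ρ.H) ξ) ∂haarCircle := by
        simp only [map_smul, smul_apply]
    _ = ρ.π a (ρ.isotypicProj n ξ) :=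
        (ρ.π a).integral_comp_comm (ρ.integrable_zpow_smul_U _ ξ)

end CovariantRep

end CircleAction

/-! ### The crossed product -/

theorem dense_of_forall_mem_closure {B : Type*} [NonUnitalCStarAlgebra B] {S : Set B}
    {C : NonUnitalStarSubalgebra ℂ B}
    (hC : C = (NonUnitalStarAlgebra.adjoin ℂ S).topologicalClosure)
    {K : NonUnitalStarSubalgebra ℂ C} (h : ∀ x : C, (x : B) ∈ S → x ∈ closure (K : Set C)) :
    Dense (K : Set C) := by
  have : ContinuousStar C := ⟨(continuous_star.comp continuous_subtype_val).subtype_mk _⟩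
  have isClosed_C : IsClosed (C : Set B) := by
    rw [hC]
    exact NonUnitalStarSubalgebra.isClosed_topologicalClosure _
  have subset_C : S ⊆ C := by
    rw [hC]
    exact fun x hx => subset_closure (NonUnitalStarAlgebra.subset_adjoin ℂ S hx)
  let L : NonUnitalStarSubalgebra ℂ B :=
    K.topologicalClosure.map (NonUnitalStarSubalgebraClass.subtype C)
  have isClosed_L : IsClosed (L : Set B) := by
    rw [NonUnitalStarSubalgebra.coe_map]
    exact isClosed_C.isClosedEmbedding_subtypeVal.isClosedMap _
      (NonUnitalStarSubalgebra.isClosed_topologicalClosure K)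
  have subset_L : S ⊆ L := fun x hx =>
    NonUnitalStarSubalgebra.mem_map.mpr ⟨⟨x, subset_C hx⟩, h ⟨x, subset_C hx⟩ hx, rfl⟩
  have le_L : C ≤ L := hC.trans_le <| NonUnitalStarSubalgebra.topologicalClosure_minimal _
    (NonUnitalStarAlgebra.adjoin_le_iff.mpr subset_L) isClosed_L
  intro x
  obtain ⟨y, hy, hyx⟩ := NonUnitalStarSubalgebra.mem_map.mp (le_L x.2)
  rwa [← Subtype.ext hyx]

namespace CircleAction

variable {A : Type u} [CStarAlgebra A] {α : CircleAction A}

-- The default search for this instance times out.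
noncomputable instance instZeroCrossedProduct : Zero α.crossedProduct := MulZeroClass.toZero

theorem CovariantRep.integrated_add (ρ : CovariantRep α) (f g : C(Circle, A)) :
    ρ.integrated (f + g) = ρ.integrated f + ρ.integrated g := by
  ext ξ
  calc ∫ ζ, ρ.π (f ζ + g ζ) ((ρ.U ζ : ρ.H →L[ℂ] ρ.H) ξ) ∂haarCircle
      = ∫ ζ, (ρ.π (f ζ) ((ρ.U ζ : ρ.H →L[ℂ] ρ.H) ξ) +
          ρ.π (g ζ) ((ρ.U ζ : ρ.H →L[ℂ] ρ.H) ξ)) ∂haarCircle := by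
        simp only [map_add, add_apply]
    _ = ρ.integrated f ξ + ρ.integrated g ξ :=
        integral_add (ρ.integrable_integrand f ξ) (ρ.integrable_integrand g ξ)

theorem CovariantRep.integrated_smul (ρ : CovariantRep α) (c : ℂ) (f : C(Circle, A)) :
    ρ.integrated (c • f) = c • ρ.integrated f := by
  ext ξ
  calc ∫ ζ, ρ.π (c • f ζ) ((ρ.U ζ : ρ.H →L[ℂ] ρ.H) ξ) ∂haarCircle
      = ∫ ζ, c • ρ.π (f ζ) ((ρ.U ζ : ρ.H →L[ℂ] ρ.H) ξ) ∂haarCircle := by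
        simp only [map_smul, smul_apply]
    _ = c • ρ.integrated f ξ := integral_smul c _

@[ext]
theorem crossedProduct_ext {x y : α.crossedProduct}
    (h : ∀ ρ : CovariantRep α, (x : lp (fun ρ : CovariantRep α => ρ.H →L[ℂ] ρ.H) ∞) ρ =
      (y : lp (fun ρ : CovariantRep α => ρ.H →L[ℂ] ρ.H) ∞) ρ) : x = y :=
  Subtype.ext (lp.ext (funext h))

variable (α) in
/-- The canonical map of `C(Circle, A)` into the crossed product, as a bounded linear map. -/
noncomputable def toCrossedProduct : C(Circle, A) →L[ℂ] α.crossedProduct :=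
  LinearMap.mkContinuous
    { toFun := fun f => ⟨α.universalRep f,
        subset_closure (NonUnitalStarAlgebra.subset_adjoin ℂ _ (Set.mem_range_self f))⟩
      map_add' := fun f g => crossedProduct_ext fun ρ => ρ.integrated_add f g
      map_smul' := fun c f => crossedProduct_ext fun ρ => ρ.integrated_smul c f }
    1 fun f => by
      rw [one_mul]
      exact lp.norm_le_of_forall_le (norm_nonneg f) fun ρ => ρ.norm_integrated_le f

variable (α) in
/-- The elements `a Pₙ` of the crossed product, where `Pₙ` stands for the projection onto the
isotypic component of the unitary representation at the character `ζ ↦ ζⁿ`. -/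
noncomputable def mulProj (n : ℤ) : A →ₗ[ℂ] α.crossedProduct :=
  (α.toCrossedProduct ∘L monomial (-n)).toLinearMap

theorem mulProj_apply (n : ℤ) (a : A) :
    α.mulProj n a = α.toCrossedProduct (monomial (-n) a) :=
  rfl

theorem coe_mulProj_apply (n : ℤ) (a : A) (ρ : CovariantRep α) :
    (α.mulProj n a : lp (fun ρ : CovariantRep α => ρ.H →L[ℂ] ρ.H) ∞) ρ =
      ρ.π a * ρ.isotypicProj n :=
  ρ.integrated_monomial n a

theorem mulProj_mul_mulProj (m n : ℤ) (a : A) {k : ℤ} {b : A} (hb : b ∈ α.spectralSubspace k) :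
    α.mulProj m a * α.mulProj n b = if m = n + k then α.mulProj n (a * b) else 0 := by
  ext ρ : 1
  have product : (ρ.π a * ρ.isotypicProj m) * (ρ.π b * ρ.isotypicProj n) =
      if m = n + k then ρ.π (a * b) * ρ.isotypicProj n else 0 := by
    calc (ρ.π a * ρ.isotypicProj m) * (ρ.π b * ρ.isotypicProj n)
        = ρ.π a * (ρ.isotypicProj m * ρ.π b) * ρ.isotypicProj n := by simp only [mul_assoc]
      _ = ρ.π (a * b) * (ρ.isotypicProj (m - k) * ρ.isotypicProj n) := by
        rw [ρ.isotypicProj_mul_π m hb, map_mul]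
        simp only [mul_assoc]
      _ = _ := by
        rw [ρ.isotypicProj_mul_isotypicProj, mul_ite, mul_zero]
        simp only [sub_eq_iff_eq_add]
  calc _ = (ρ.π a * ρ.isotypicProj m) * (ρ.π b * ρ.isotypicProj n) := by
        rw [← coe_mulProj_apply, ← coe_mulProj_apply]; rfl
    _ = _ := by
        rw [product]
        split_ifs
        · exact (coe_mulProj_apply n (a * b) ρ).symm
        · rfl

theorem star_mulProj (n : ℤ) {k : ℤ} {a : A} (ha : a ∈ α.spectralSubspace k) :
    star (α.mulProj n a) = α.mulProj (n + k) (star a) := by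
  ext ρ : 1
  calc _ = star (ρ.π a * ρ.isotypicProj n) := by rw [← coe_mulProj_apply]; rfl
    _ = ρ.π (star a) * ρ.isotypicProj (n + k) := by
        rw [star_mul, ρ.star_isotypicProj, ← map_star,
          ρ.isotypicProj_mul_π n (α.star_mem_spectralSubspace ha), sub_neg_eq_add]
    _ = _ := (coe_mulProj_apply _ _ ρ).symm

section MatrixUnits

variable {v : unitary A}

theorem coe_zpow_mul_coe_zpow (v : unitary A) (i j : ℤ) :
    ((v ^ i : unitary A) : A) * ((v ^ j : unitary A) : A) = ((v ^ (i + j) : unitary A) : A) := by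
  rw [← Submonoid.coe_mul, zpow_add]

theorem star_coe_zpow (v : unitary A) (i : ℤ) :
    star ((v ^ i : unitary A) : A) = ((v ^ (-i) : unitary A) : A) := by
  rw [zpow_neg, ← Unitary.star_eq_inv, Unitary.coe_star]

theorem zpow_mul_mul_zpow_mem_spectralSubspace (hv : v ∈ α.eigenunitaries) (i j : ℤ) {k : ℤ} {a : A}
    (ha : a ∈ α.spectralSubspace k) :
    ((v ^ i : unitary A) : A) * a * ((v ^ j : unitary A) : A) ∈ α.spectralSubspace (i + k + j) :=
  mul_mem_spectralSubspace (mul_mem_spectralSubspace (zpow_mem_spectralSubspace hv i) ha)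
    (zpow_mem_spectralSubspace hv j)

theorem mulProj_zpow_mul_mul_zpow_mul (hv : v ∈ α.eigenunitaries) (i j k l : ℤ) (a : A) {b : A}
    (hb : b ∈ α.fixedPoints) :
    α.mulProj j (((v ^ i : unitary A) : A) * a * ((v ^ (-j) : unitary A) : A)) *
        α.mulProj l (((v ^ k : unitary A) : A) * b * ((v ^ (-l) : unitary A) : A)) =
      if j = k then
        α.mulProj l (((v ^ i : unitary A) : A) * (a * b) * ((v ^ (-l) : unitary A) : A))
      else 0 := by
  rw [mulProj_mul_mulProj j l _ (zpow_mul_mul_zpow_mem_spectralSubspace hv k (-l)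
    (mem_spectralSubspace_zero.mpr hb)), add_zero, add_neg_cancel_comm_assoc]
  refine ite_congr rfl (fun hjk => congrArg (α.mulProj l) ?_) fun _ => rfl
  calc ((v ^ i : unitary A) : A) * a * ((v ^ (-j) : unitary A) : A) *
        (((v ^ k : unitary A) : A) * b * ((v ^ (-l) : unitary A) : A))
      = ((v ^ i : unitary A) : A) * a * (((v ^ (-j) : unitary A) : A) *
          ((v ^ k : unitary A) : A)) * b * ((v ^ (-l) : unitary A) : A) := by
        simp only [mul_assoc]
    _ = ((v ^ i : unitary A) : A) * (a * b) * ((v ^ (-l) : unitary A) : A) := by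
        rw [coe_zpow_mul_coe_zpow, hjk, neg_add_cancel, zpow_zero, OneMemClass.coe_one, mul_one,
          mul_assoc _ a]

theorem star_mulProj_zpow_mul_mul_zpow (hv : v ∈ α.eigenunitaries) (i j : ℤ) {a : A}
    (ha : a ∈ α.fixedPoints) :
    star (α.mulProj j (((v ^ i : unitary A) : A) * a * ((v ^ (-j) : unitary A) : A))) =
      α.mulProj i (((v ^ j : unitary A) : A) * star a * ((v ^ (-i) : unitary A) : A)) := by
  rw [star_mulProj j (zpow_mul_mul_zpow_mem_spectralSubspace hv i (-j)
    (mem_spectralSubspace_zero.mpr ha)), add_zero, add_add_neg_cancel'_right, star_mul, star_mul,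
    star_coe_zpow, star_coe_zpow, neg_neg, ← mul_assoc]

/-- The matrix units `vⁱ d v⁻ʲ Pⱼ` of the crossed product, for `d` in the fixed point algebra. They
identify `A ⋊ 𝕋` with the `ℤ × ℤ` matrices over the fixed point algebra. -/
noncomputable def matrixUnits (hv : v ∈ α.eigenunitaries) :
    MatrixUnits ℤ α.fixedPoints α.crossedProduct where
  entry i j := α.mulProj j ∘ₗ
    LinearMap.mulLeftRight ℂ (((v ^ i : unitary A) : A), ((v ^ (-j) : unitary A) : A)) ∘ₗ
    α.fixedPoints.subtype.toLinearMap
  entry_mul_entry i j k l a b := mulProj_zpow_mul_mul_zpow_mul hv i j k l a b.2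
  star_entry i j a := star_mulProj_zpow_mul_mul_zpow hv i j a.2

theorem matrixUnits_entry_apply (hv : v ∈ α.eigenunitaries) (i j : ℤ) (d : α.fixedPoints) :
    (matrixUnits hv).entry i j d =
      α.mulProj j (((v ^ i : unitary A) : A) * d * ((v ^ (-j) : unitary A) : A)) :=
  rfl

theorem mulProj_mem_entrySpan (hv : v ∈ α.eigenunitaries) (n : ℤ) {k : ℤ} {a : A}
    (ha : a ∈ α.spectralSubspace k) : α.mulProj n a ∈ (matrixUnits hv).entrySpan := by
  have hd : ((v ^ (-(n + k)) : unitary A) : A) * a * ((v ^ n : unitary A) : A) ∈ α.fixedPoints := by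
    simpa [mem_spectralSubspace_zero] using
      zpow_mul_mul_zpow_mem_spectralSubspace hv (-(n + k)) n ha
  have entry_eq : (matrixUnits hv).entry (n + k) n ⟨_, hd⟩ = α.mulProj n a := by
    rw [matrixUnits_entry_apply]
    congr 1
    calc _ = (((v ^ (n + k) : unitary A) : A) * ((v ^ (-(n + k)) : unitary A) : A)) * a *
            (((v ^ n : unitary A) : A) * ((v ^ (-n) : unitary A) : A)) := by
          simp only [mul_assoc]
      _ = a := by
          simp only [coe_zpow_mul_coe_zpow, add_neg_cancel, zpow_zero, OneMemClass.coe_one, one_mul,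
            mul_one]
  rw [← entry_eq]
  exact MatrixUnits.entry_mem_entrySpan _ _ _ _

theorem dense_entrySpan_matrixUnits (hv : v ∈ α.eigenunitaries) :
    Dense ((matrixUnits hv).entrySpan : Set α.crossedProduct) := by
  refine dense_of_forall_mem_closure rfl ?_
  rintro ⟨_, _⟩ ⟨f, rfl⟩
  refine map_mem_closure_of_forall_monomial_mem α α.toCrossedProduct
    (M := α.crossedProduct) (K := (matrixUnits hv).entrySpan.toSubmodule) (fun n k a ha => ?_) f
  have mulProj_mem := mulProj_mem_entrySpan hv (-n) ha
  rwa [mulProj_apply, neg_neg] at mulProj_mem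

theorem matrixUnits_entry_one_ne_zero (hv : v ∈ α.eigenunitaries) (ρ : CovariantRep α) {ξ : ρ.H}
    (hξ : ξ ≠ 0) (U_ξ : ∀ ζ, (ρ.U ζ : ρ.H →L[ℂ] ρ.H) ξ = ξ) :
    (matrixUnits hv).entry 0 0 1 ≠ 0 := by
  intro entry_eq_zero
  have isotypicProj_ξ : ρ.isotypicProj 0 ξ = ξ :=
    (ρ.toIsometricCircleRep.weightProj_apply_of_mem (m := 0)
      (fun ζ => by rw [zpow_zero, one_smul]; exact U_ξ ζ) 0).trans (if_pos rfl)
  have isotypicProj_eq_zero : ρ.isotypicProj 0 = 0 := by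
    have := coe_mulProj_apply 0 (1 : A) ρ
    have h1 : α.mulProj 0 1 = 0 := by simpa [matrixUnits_entry_apply] using entry_eq_zero
    rw [h1, map_one, one_mul] at this
    exact this.symm
  rw [isotypicProj_eq_zero] at isotypicProj_ξ
  exact hξ isotypicProj_ξ.symm

end MatrixUnits

end CircleAction

/-! ### Invariant states -/

open scoped ComplexOrder

section Positivity

variable {A : Type*} [CStarAlgebra A] [Nontrivial A] {g : A →ₗ[ℂ] ℂ}

theorem sq_norm_add_smul_I_le {a : A} (ha : IsSelfAdjoint a) (t : ℝ) :
    ‖a + ((t : ℂ) * Complex.I) • (1 : A)‖ ^ 2 ≤ ‖a‖ ^ 2 + t ^ 2 := by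
  have star_smul_I : star (((t : ℂ) * Complex.I) • (1 : A)) = -(((t : ℂ) * Complex.I) • 1) := by
    simp [star_smul]
  have sq_smul_I : ((t : ℂ) * Complex.I) * ((t : ℂ) * Complex.I) = -((t : ℂ) ^ 2) := by
    linear_combination (t : ℂ) ^ 2 * Complex.I_mul_I
  have star_mul_self_eq : star (a + ((t : ℂ) * Complex.I) • (1 : A)) *
      (a + ((t : ℂ) * Complex.I) • 1) = a * a + ((t : ℂ) ^ 2) • (1 : A) := by
    rw [star_add, ha.star_eq, star_smul_I]
    simp only [add_mul, mul_add, neg_mul, smul_mul_assoc, mul_smul_comm, one_mul, mul_one,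
      smul_add, smul_neg, smul_smul, sq_smul_I, neg_smul, neg_neg]
    abel
  rw [pow_two, ← CStarRing.norm_star_mul_self, star_mul_self_eq]
  refine (norm_add_le _ _).trans (add_le_add ?_ ?_)
  · rw [pow_two]
    exact norm_mul_le a a
  · rw [norm_smul, norm_one, mul_one, norm_pow, Complex.norm_real, Real.norm_eq_abs, sq_abs]

theorem im_apply_eq_zero_of_norm_le_of_map_one (hg : ∀ a, ‖g a‖ ≤ ‖a‖) (hg1 : g 1 = 1) {a : A}
    (ha : IsSelfAdjoint a) : (g a).im = 0 := by
  have im_bound (t : ℝ) : 2 * t * (g a).im ≤ ‖a‖ ^ 2 := by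
    have norm_le := hg (a + ((t : ℂ) * Complex.I) • 1)
    rw [map_add, map_smul, hg1, smul_eq_mul, mul_one] at norm_le
    have norm_sq : ‖g a + (t : ℂ) * Complex.I‖ ^ 2 = (g a).re ^ 2 + ((g a).im + t) ^ 2 := by
      rw [← Complex.normSq_eq_norm_sq, Complex.normSq_apply]
      simp [pow_two]
    have := (pow_le_pow_left₀ (norm_nonneg _) norm_le 2).trans (sq_norm_add_smul_I_le ha t)
    nlinarith [sq_nonneg (g a).re, sq_nonneg (g a).im]
  by_contra hne
  have := im_bound ((‖a‖ ^ 2 + 1) / (g a).im)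
  rw [mul_assoc, div_mul_cancel₀ _ hne] at this
  linarith [sq_nonneg ‖a‖]

theorem nonneg_of_norm_le_of_map_one [PartialOrder A] [StarOrderedRing A]
    (hg : ∀ a, ‖g a‖ ≤ ‖a‖) (hg1 : g 1 = 1) {a : A} (ha : 0 ≤ a) : 0 ≤ g a := by
  have norm_sub_le : ‖algebraMap ℝ A ‖a‖ - a‖ ≤ ‖a‖ := by
    have sub_nonneg : 0 ≤ algebraMap ℝ A ‖a‖ - a :=
      sub_nonneg.mpr (IsSelfAdjoint.of_nonneg ha).le_algebraMap_norm_self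
    simpa using CStarAlgebra.norm_le_norm_of_nonneg_of_le sub_nonneg (sub_le_self _ ha)
  have g_algebraMap : g (algebraMap ℝ A ‖a‖) = (‖a‖ : ℂ) := by
    rw [Algebra.algebraMap_eq_smul_one, ← Complex.coe_smul, map_smul, hg1, smul_eq_mul, mul_one]
  have re_le := (Complex.re_le_norm _).trans ((hg _).trans norm_sub_le)
  rw [map_sub, g_algebraMap, Complex.sub_re, Complex.ofReal_re] at re_le
  rw [Complex.le_def]
  exact ⟨by rw [Complex.zero_re]; linarith,
    (im_apply_eq_zero_of_norm_le_of_map_one hg hg1 (.of_nonneg ha)).symm⟩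

end Positivity

section Completion

open UniformSpace Completion

variable {𝕜 E : Type*} [NontriviallyNormedField 𝕜] [SeminormedAddCommGroup E] [NormedSpace 𝕜 E]

theorem completion_one_apply (x : Completion E) : (1 : E →L[𝕜] E).completion x = x := by
  induction x using induction_on with
  | hp => apply isClosed_eq <;> fun_prop
  | ih x => simp

theorem completion_apply_apply {f g h : E →L[𝕜] E} (hfg : ∀ x, f (g x) = h x)
    (x : Completion E) : f.completion (g.completion x) = h.completion x := by
  induction x using induction_on with
  | hp => apply isClosed_eq <;> fun_prop
  | ih x => simp [hfg]

theorem norm_completion_apply {f : E →L[𝕜] E} (hf : ∀ x, ‖f x‖ = ‖x‖) (x : Completion E) :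
    ‖f.completion x‖ = ‖x‖ := by
  induction x using induction_on with
  | hp => apply isClosed_eq <;> fun_prop
  | ih x => rw [f.completion_apply_coe, norm_coe, norm_coe, hf]

variable (𝕜 E) in
/-- Functoriality of the completion on linear isometric automorphisms. -/
noncomputable def completionIsometryHom :
    (E ≃ₗᵢ[𝕜] E) →* (Completion E ≃ₗᵢ[𝕜] Completion E) where
  toFun e :=
    { (e : E →L[𝕜] E).completion with
      invFun := (e.symm : E →L[𝕜] E).completion
      left_inv := fun x => (completion_apply_apply (h := 1) e.symm_apply_apply x).trans
        (completion_one_apply x)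
      right_inv := fun x => (completion_apply_apply (h := 1) e.apply_symm_apply x).trans
        (completion_one_apply x)
      norm_map' := norm_completion_apply e.norm_map }
  map_one' := LinearIsometryEquiv.ext completion_one_apply
  map_mul' _ _ := LinearIsometryEquiv.ext fun x =>
    (completion_apply_apply (fun _ => rfl) x).symm

theorem completionIsometryHom_apply_coe (e : E ≃ₗᵢ[𝕜] E) (x : E) :
    completionIsometryHom 𝕜 E e (x : Completion E) = (e x : E) :=
  (e : E →L[𝕜] E).completion_apply_coe x

end Completion

namespace CircleAction

variable {A : Type u} [CStarAlgebra A] (α : CircleAction A)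

theorem exists_invariant_state [Nontrivial A] [PartialOrder A] [StarOrderedRing A] :
    ∃ φ : A →ₚ[ℂ] ℂ, φ 1 = 1 ∧ (∀ ζ a, φ (α ζ a) = φ a) ∧ ∀ a, ‖φ a‖ ≤ ‖a‖ := by
  obtain ⟨f, hf, f_one⟩ := exists_dual_vector ℂ (1 : A) (norm_ne_zero_iff.mpr one_ne_zero)
  let g : A →L[ℂ] ℂ := f.comp (α.spectralProj 0)
  have norm_g_le (a : A) : ‖g a‖ ≤ ‖a‖ :=
    (f.le_of_opNorm_le hf.le _).trans (by
      rw [one_mul]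
      exact α.toIsometricCircleRep.norm_weightProj_apply_le 0 a)
  have g_one : g 1 = 1 := by
    rw [ContinuousLinearMap.comp_apply, spectralProj_one, f_one, norm_one, RCLike.ofReal_one]
  have g_invariant (ζ : Circle) (a : A) : g (α ζ a) = g a := by
    have := α.toIsometricCircleRep.weightProj_apply_apply 0 ζ a
    rw [zpow_zero, one_smul] at this
    exact congrArg f this
  exact ⟨PositiveLinearMap.mk₀ (g : A →ₗ[ℂ] ℂ) fun _ =>
    nonneg_of_norm_le_of_map_one (g := (g : A →ₗ[ℂ] ℂ)) norm_g_le g_one, g_one, g_invariant,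
    norm_g_le⟩

section GNS

open UniformSpace Completion

variable [PartialOrder A] [StarOrderedRing A] {α} {φ : A →ₚ[ℂ] ℂ}

/-- The action on the GNS pre-Hilbert space of an invariant state; the values are isometric
because the state is invariant. -/
noncomputable def preGNSHom (hφ : ∀ ζ a, φ (α ζ a) = φ a) :
    Circle →* (φ.PreGNS ≃ₗᵢ[ℂ] φ.PreGNS) where
  toFun ζ :=
    { (φ.ofPreGNS.trans (α ζ).toAlgEquiv.toLinearEquiv).trans φ.toPreGNS with
      norm_map' := fun x => by
        change ‖φ.toPreGNS (α ζ (φ.ofPreGNS x))‖ = ‖x‖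
        rw [φ.preGNS_norm_def, φ.preGNS_norm_def, φ.ofPreGNS_toPreGNS, ← map_star, ← map_mul, hφ] }
  map_one' := by ext x; exact DFunLike.congr_fun (map_one α.toHom) x
  map_mul' ζ η := by ext x; exact DFunLike.congr_fun (map_mul α.toHom ζ η) x

theorem norm_toPreGNS_le (norm_φ_le : ∀ a, ‖φ a‖ ≤ ‖a‖) (a : A) : ‖φ.toPreGNS a‖ ≤ ‖a‖ := by
  rw [φ.preGNS_norm_def, φ.ofPreGNS_toPreGNS]
  refine Real.sqrt_le_iff.mpr ⟨norm_nonneg a, ?_⟩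
  rw [pow_two, ← CStarRing.norm_star_mul_self]
  exact (Complex.re_le_norm _).trans (norm_φ_le _)

/-- The unitary representation of the circle on the GNS Hilbert space of an invariant state that
implements the action. -/
noncomputable def gnsUnitaryHom (hφ : ∀ ζ a, φ (α ζ a) = φ a) :
    Circle →* unitary (φ.GNS →L[ℂ] φ.GNS) :=
  (Unitary.linearIsometryEquiv (𝕜 := ℂ) (H := φ.GNS)).symm.toMonoidHom.comp
    ((completionIsometryHom ℂ φ.PreGNS).comp (preGNSHom hφ))

theorem gnsUnitaryHom_apply_coe (hφ : ∀ ζ a, φ (α ζ a) = φ a) (ζ : Circle) (x : φ.PreGNS) :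
    (gnsUnitaryHom hφ ζ : φ.GNS →L[ℂ] φ.GNS) x =
      (φ.toPreGNS (α ζ (φ.ofPreGNS x)) : φ.PreGNS) :=
  completionIsometryHom_apply_coe (preGNSHom hφ ζ) x

theorem continuous_gnsUnitaryHom_apply (hφ : ∀ ζ a, φ (α ζ a) = φ a)
    (norm_φ_le : ∀ a, ‖φ a‖ ≤ ‖a‖) (x : φ.GNS) :
    Continuous fun ζ => (gnsUnitaryHom hφ ζ : φ.GNS →L[ℂ] φ.GNS) x := by
  have continuous_toPreGNS : Continuous φ.toPreGNS :=
    AddMonoidHomClass.continuous_of_bound φ.toPreGNS 1 fun a => by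
      rw [one_mul]
      exact norm_toPreGNS_le norm_φ_le a
  have continuous_coe_apply (y : φ.PreGNS) :
      Continuous fun ζ => (gnsUnitaryHom hφ ζ : φ.GNS →L[ℂ] φ.GNS) y := by
    simp only [gnsUnitaryHom_apply_coe]
    exact (continuous_coe _).comp (continuous_toPreGNS.comp (α.continuous_apply _))
  refine continuous_of_uniform_approx_of_continuous fun V hV => ?_
  obtain ⟨ε, hε, hεV⟩ := Metric.mem_uniformity_dist.mp hV
  obtain ⟨y, hy⟩ := Metric.mem_closure_range_iff.mp (denseRange_coe x) ε hε
  refine ⟨_, continuous_coe_apply y, fun ζ => hεV ?_⟩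
  rw [dist_eq_norm, ← map_sub, ContinuousLinearMap.norm_map_of_mem_unitary (gnsUnitaryHom hφ ζ).2,
    ← dist_eq_norm]
  exact hy

theorem gnsUnitaryHom_mul_gnsStarAlgHom (hφ : ∀ ζ a, φ (α ζ a) = φ a) (ζ : Circle) (a : A) :
    (gnsUnitaryHom hφ ζ : φ.GNS →L[ℂ] φ.GNS) * φ.gnsStarAlgHom a =
      φ.gnsStarAlgHom (α ζ a) * (gnsUnitaryHom hφ ζ : φ.GNS →L[ℂ] φ.GNS) := by
  ext x
  induction x using induction_on with
  | hp => apply isClosed_eq <;> fun_prop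
  | ih x =>
    have gnsStarAlgHom_apply (b : A) (y : φ.PreGNS) :
        φ.gnsStarAlgHom b (y : φ.GNS) = (φ.toPreGNS (b * φ.ofPreGNS y) : φ.PreGNS) :=
      φ.gnsNonUnitalStarAlgHom_apply_coe
    rw [mul_apply_eq_comp, mul_apply_eq_comp, gnsUnitaryHom_apply_coe, gnsStarAlgHom_apply,
      gnsStarAlgHom_apply, gnsUnitaryHom_apply_coe, φ.ofPreGNS_toPreGNS, φ.ofPreGNS_toPreGNS,
      map_mul]

/-- The GNS representation of an invariant state, as a covariant representation. -/
noncomputable def gnsCovariantRep (hφ : ∀ ζ a, φ (α ζ a) = φ a)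
    (norm_φ_le : ∀ a, ‖φ a‖ ≤ ‖a‖) : CovariantRep α where
  H := φ.GNS
  π := φ.gnsStarAlgHom
  U := gnsUnitaryHom hφ
  continuous_U := continuous_gnsUnitaryHom_apply hφ norm_φ_le
  covariant ζ a := by
    rw [gnsUnitaryHom_mul_gnsStarAlgHom, mul_assoc,
      Unitary.mul_star_self_of_mem (SetLike.coe_mem _), mul_one]

end GNS

theorem exists_covariantRep_invariant_vector [Nontrivial A] :
    ∃ (ρ : CovariantRep α) (ξ : ρ.H), ξ ≠ 0 ∧ ∀ ζ, (ρ.U ζ : ρ.H →L[ℂ] ρ.H) ξ = ξ := by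
  let _ := CStarAlgebra.spectralOrder A
  have := CStarAlgebra.spectralOrderedRing A
  obtain ⟨φ, φ_one, hφ, norm_φ_le⟩ := α.exists_invariant_state
  refine ⟨gnsCovariantRep hφ norm_φ_le, ((φ.toPreGNS 1 : φ.PreGNS) : φ.GNS), fun coe_eq_zero => ?_,
    fun ζ => ?_⟩
  · have norm_eq_zero : ‖((φ.toPreGNS 1 : φ.PreGNS) : φ.GNS)‖ = 0 :=
      (congrArg norm coe_eq_zero).trans norm_zero
    rw [UniformSpace.Completion.norm_coe, φ.preGNS_norm_def, φ.ofPreGNS_toPreGNS] at norm_eq_zero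
    simp [φ_one] at norm_eq_zero
  · refine (gnsUnitaryHom_apply_coe hφ ζ _).trans ?_
    rw [φ.ofPreGNS_toPreGNS, map_one]

theorem HasRokhlinProperty.isPurelyInfiniteSimple_crossedProduct {α : CircleAction A}
    (hα : α.HasRokhlinProperty) (hA : IsPurelyInfiniteSimple A) :
    IsPurelyInfiniteSimple α.crossedProduct := by
  have : Nontrivial A := hA.1.1
  have hD := hα.isPurelyInfiniteSimple_fixedPoints hA
  obtain ⟨v, hv, -⟩ := hα.exists_asymptoticallyCentral
  obtain ⟨s, hs⟩ := hD.exists_orthogonal_isometries (hα.not_forall_eq_algebraMap hA)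
  obtain ⟨ρ, ξ, hξ, U_ξ⟩ := α.exists_covariantRep_invariant_vector
  have hv := hv (∅, 0)
  refine MatrixUnits.isPurelyInfiniteSimple (dense_entrySpan_matrixUnits hv) hD
    (matrixUnits_entry_one_ne_zero hv ρ hξ U_ξ) (s := fun p => s (Encodable.encode p))
    fun p q => ?_
  simp only [hs, Encodable.encode_inj]

end CircleAction

theorem mainTheorem5 {A : Type u} [CStarAlgebra A] (hA : IsPurelyInfiniteSimple A)
    (α : CircleAction A) (hα : α.HasRokhlinProperty) :
    IsPurelyInfiniteSimple α.fixedPoints ∧ IsPurelyInfiniteSimple α.crossedProduct :=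
  ⟨hα.isPurelyInfiniteSimple_fixedPoints hA, hα.isPurelyInfiniteSimple_crossedProduct hA⟩
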